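/- All graphs are finite, nonnull and loopless; multiple edges are allowed. For a graph $G$, $d_G(v)$ denotes the number of edges incident with the vertex $v$. For an integer $k\ge 1$, $G$ is $k$-edge-connected if it remains connected after the removal of any set of fewer than $k$ edges (so a one-vertex graph is $k$-edge-connected for every $k$). A closed walk $v_0,e_1,v_1,\dots,e_n,v_n=v_0$ with $n\ge 1$ meets a vertex $v$ exactly $|\{i : 1\le i\le n,\ v_i=v\}|$ times; the trivial closed walk ($n=0$) meets its vertex once. A trail is a walk without repeated edges, and a closed walk or trail is spanning if it meets every vertex of $G$. Let $G$ be a graph. 1. Let $k\ge 4$ be an integer. If $G$ is $k$-edge-connected, then $G$ has a spanning closed trail that meets each vertex $v$ at most $\left\lceil\frac{d_G(v)+k/2-4}{k}\right\rceil+1$ times. 2. Let $k\in\{1,2,3\}$, and if $k=1$ assume that $G$ has at least two vertices. If $G$ is $k$-edge-connected, then $G$ has a spanning closed walk that meets each vertex $v$ at most $\left\lceil\frac{d_G(v)-1}{k}\right\rceil+1$ times. 3. Let $4\le r\le 8$ be an integer. If $G$ is $r$-edge-connected and $r$-regular, then $G$ has a connected $\{2,4\}$-factor, that is, a connected spanning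 subgraph in which every vertex has degree $2$ or $4$. -/

import Mathlib

/-! Multigraphs are Mathlib's `Graph α β`: parallel edges are allowed, and loops are excluded by
the class `Graph.Loopless`. -/

open scoped Graph

universe u v

namespace Graph

/-- The degree of a vertex: the number of edges incident with it. (In a loopless finite graph, this
is the usual degree.) -/
noncomputable def degree {α : Type u} {β : Type v} (G : Graph α β) (x : α) : ℕ :=
  (G.incidenceSet x).ncard

/-- Every vertex has degree `r`. -/
def IsRegular {α : Type u} {β : Type v} (G : Graph α β) (r : ℕ) : Prop :=
  ∀ x ∈ V(G), G.degree x = r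

/-- Walks in a multigraph, as alternating sequences of vertices and edges; vertices and edges may
be repeated. -/
inductive Walk {α : Type u} {β : Type v} (G : Graph α β) : α → α → Type (max u v)
  | nil {x : α} (hx : x ∈ V(G)) : Walk G x x
  | cons {x y z : α} (e : β) (h : G.IsLink e x y) (p : Walk G y z) : Walk G x z

namespace Walk

variable {α : Type u} {β : Type v} {G : Graph α β}

/-- The sequence of vertices of a walk, including both its first and its last vertex. -/
def support {x y : α} : G.Walk x y → List α
  | nil (x := x) _ => [x]
  | cons (x := x) _ _ p => x :: p.support

/-- The sequence of edges of a walk. -/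
def edges {x y : α} : G.Walk x y → List β
  | nil _ => []
  | cons e _ p => e :: p.edges

/-- A trail is a walk that uses no edge more than once. -/
def IsTrail {x y : α} (p : G.Walk x y) : Prop := p.edges.Nodup

/-- A walk is spanning if it contains every vertex of the graph. -/
def IsSpanning {x y : α} (p : G.Walk x y) : Prop := ∀ z ∈ V(G), z ∈ p.support

open Classical in
/-- The number of times a closed walk meets `z`. The coincidence of the last vertex with the first
one is not counted as an additional visit to the initial vertex; the trivial walk meets its only
vertex once. -/
noncomputable def visits {x : α} (p : G.Walk x x) (z : α) : ℕ :=
  if p.edges = [] then p.support.count z else p.support.tail.count z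

end Walk

/-- An `f`-walk: a spanning closed walk that meets each vertex `x` at most `f x` times. -/
def HasFWalk {α : Type u} {β : Type v} (G : Graph α β) (f : α → ℤ) : Prop :=
  ∃ (x : α) (p : G.Walk x x), p.IsSpanning ∧ ∀ z ∈ V(G), (p.visits z : ℤ) ≤ f z

/-- An `f`-trail: a spanning closed trail that meets each vertex `x` at most `f x` times. -/
def HasFTrail {α : Type u} {β : Type v} (G : Graph α β) (f : α → ℤ) : Prop :=
  ∃ (x : α) (p : G.Walk x x), p.IsTrail ∧ p.IsSpanning ∧ ∀ z ∈ V(G), (p.visits z : ℤ) ≤ f z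

/-- A graph is connected if it is nonnull and any two of its vertices are joined by a walk. -/
def Connected {α : Type u} {β : Type v} (G : Graph α β) : Prop :=
  V(G).Nonempty ∧ ∀ x ∈ V(G), ∀ y ∈ V(G), Nonempty (G.Walk x y)

/-- A graph is `k`-edge-connected if it stays connected after the removal of any set of fewer than
`k` edges. -/
def EdgeConnected {α : Type u} {β : Type v} (G : Graph α β) (k : ℕ) : Prop :=
  ∀ F : Finset β, (F : Set β) ⊆ E(G) → F.card < k → (G.deleteEdges (F : Set β)).Connected

/-- An `A`-factor of `G` is a spanning subgraph whose degrees all lie in `A`. -/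
def IsFactor {α : Type u} {β : Type v} (H G : Graph α β) (A : Set ℕ) : Prop :=
  H ≤s G ∧ ∀ x ∈ V(H), H.degree x ∈ A

end Graph

/-! Give every edge two ends, so that edge sets on the same ends can be compared. Call an edge set
`H` sparse if `|H[Y]| ≤ 2|Y| - 2` for all nonempty `Y`, and call `Y` tight if equality holds. If the
whole vertex set `V` is tight, then `H` has a vertex of degree two or three, and an induction that
splits off this vertex shows that `H` contains two disjoint connected spanning edge sets.

In a `k`-edge-connected graph with `k ≥ 4` there is such an `H` whose degrees satisfy any bound `h`
with `k * h v ≥ 2 * d v + 4 * k - 8`. Take `H` with the least total excess over `h`, and let `R` be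
the greatest set of vertices whose degree can be pushed below `h` by changes inside tight subsets of
`R`. If two vertices of `R` are joined by an edge outside `H` and lie in no common tight subset of
`R`, an exchange along this edge enlarges `R`. Hence all these edges lie inside the maximal tight
subsets of `R`. As these have at least `k` leaving edges each, counting edges shows that the total
degree in `H` outside `R` is too small for a vertex that violates the bound.

Correcting the parity of the degrees in one of the connected spanning sets by edges of the other
gives a connected spanning edge set with even degrees at most `h`, and an Euler tour of it meets `v`
at most `h v / 2` times. For a regular graph of degree `k ≤ 8` the bound `h = 5` makes these degrees
two or four.

For `k ≤ 3` edges may be repeated. If `k = 1`, all edges are doubled and an Euler tour of the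
doubled graph is taken; if `k = 2`, doubling makes the graph `4`-edge-connected. If `k = 3`, it
suffices to double a set `J` for which all degrees become even, since then all cuts are even and so
have at least four edges. Tutte's theorem, applied to a graph on the half-edges, provides such a `J`
with at most `d v - 2 * (d v / 3)` edges at `v`. -/

namespace Multigraph

/-- The two ends of every edge of a multigraph, listed in an arbitrary order. Together with a finite
set of edges and a finite set of vertices this describes a finite multigraph, and different edge
sets on the same ends are compared without forming subgraphs. -/
structure Ends (α β : Type*) where
  fst : β → α
  snd : β → α

namespace Ends

section Basic

variable {α β : Type*} (D : Ends α β)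

/-- The edge `e` has the ends `a` and `b`. -/
def Links (e : β) (a b : α) : Prop := D.fst e = a ∧ D.snd e = b ∨ D.fst e = b ∧ D.snd e = a

/-- All edges of `H` have both ends in `V`. -/
def EdgesIn (H : Finset β) (V : Finset α) : Prop := ∀ e ∈ H, D.fst e ∈ V ∧ D.snd e ∈ V

/-- No edge of `H` is a loop. -/
def Loopless (H : Finset β) : Prop := ∀ e ∈ H, D.fst e ≠ D.snd e

variable {D} {H H' : Finset β} {V X Y : Finset α} {e : β} {v : α}

theorem EdgesIn.mono (hH' : D.EdgesIn H' V) (hH : H ⊆ H') : D.EdgesIn H V :=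
  fun e he => hH' e (hH he)

theorem Loopless.mono (hH' : D.Loopless H') (hH : H ⊆ H') : D.Loopless H :=
  fun e he => hH' e (hH he)

variable (D) [DecidableEq α]

/-- The edges of `H` with both ends in `Y`. -/
def inside (H : Finset β) (Y : Finset α) : Finset β := H.filter fun e => D.fst e ∈ Y ∧ D.snd e ∈ Y

/-- The edges of `H` with exactly one end in `X`. -/
def cut (H : Finset β) (X : Finset α) : Finset β := H.filter fun e => ¬(D.fst e ∈ X ↔ D.snd e ∈ X)

/-- The edges of `H` incident with `v`. -/
def star (H : Finset β) (v : α) : Finset β := H.filter fun e => D.fst e = v ∨ D.snd e = v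

/-- The degree of `v` in the edge set `H`; a loop counts once. -/
def deg (H : Finset β) (v : α) : ℕ := (D.star H v).card

/-- Every cut of the multigraph with vertex set `V` and edge set `E` has at least `k` edges, that
is, this multigraph is `k`-edge-connected. -/
def CutsAtLeast (k : ℕ) (E : Finset β) (V : Finset α) : Prop :=
  ∀ X ⊆ V, X.Nonempty → X ≠ V → k ≤ (D.cut E X).card

variable {D}

theorem mem_inside : e ∈ D.inside H Y ↔ e ∈ H ∧ D.fst e ∈ Y ∧ D.snd e ∈ Y := by simp [inside]

theorem mem_cut : e ∈ D.cut H X ↔ e ∈ H ∧ ¬(D.fst e ∈ X ↔ D.snd e ∈ X) := by simp [cut]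

theorem mem_star : e ∈ D.star H v ↔ e ∈ H ∧ (D.fst e = v ∨ D.snd e = v) := by simp [star]

theorem inside_mono (hH : H ⊆ H') (hY : X ⊆ Y) : D.inside H X ⊆ D.inside H' Y := by
  grind [mem_inside]

theorem deg_mono (hH : H ⊆ H') (v : α) : D.deg H v ≤ D.deg H' v :=
  Finset.card_le_card (Finset.filter_subset_filter _ hH)

theorem EdgesIn.inside_eq (hH : D.EdgesIn H V) : D.inside H V = H := Finset.filter_true_of_mem hH

theorem EdgesIn.cut_eq_empty (hH : D.EdgesIn H V) : D.cut H V = ∅ :=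
  Finset.filter_eq_empty_iff.2 fun e he => by simp [hH e he]

theorem EdgesIn.cut_sdiff (hH : D.EdgesIn H V) (X : Finset α) : D.cut H (V \ X) = D.cut H X := by
  ext e
  have := hH e
  grind [mem_cut]

theorem card_inside_add_card_inside_le (H : Finset β) (X Y : Finset α) :
    (D.inside H X).card + (D.inside H Y).card ≤
      (D.inside H (X ∪ Y)).card + (D.inside H (X ∩ Y)).card := by
  classical
  rw [← Finset.card_union_add_card_inter]
  gcongr <;> grind [mem_inside]

theorem EdgesIn.card_eq (hH : D.EdgesIn H V) (X : Finset α) :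
    H.card = (D.inside H X).card + (D.cut H X).card + (D.inside H (V \ X)).card := by
  simp only [inside, cut, Finset.card_filter, ← Finset.sum_add_distrib]
  rw [Finset.card_eq_sum_ones]
  refine Finset.sum_congr rfl fun e he => ?_
  obtain ⟨hfst, hsnd⟩ := hH e he
  by_cases h₁ : D.fst e ∈ X <;> by_cases h₂ : D.snd e ∈ X <;> simp [h₁, h₂, hfst, hsnd]

theorem Loopless.sum_deg (hH : D.Loopless H) (X : Finset α) :
    ∑ v ∈ X, D.deg H v = (D.cut H X).card + 2 * (D.inside H X).card := by
  have hends : ∑ v ∈ X, D.deg H v = ∑ e ∈ H, (X.filter fun v => D.fst e = v ∨ D.snd e = v).card :=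
    Finset.sum_card_bipartiteAbove_eq_sum_card_bipartiteBelow fun v e => D.fst e = v ∨ D.snd e = v
  rw [hends, cut, inside, Finset.card_filter, Finset.card_filter, Finset.mul_sum,
    ← Finset.sum_add_distrib]
  refine Finset.sum_congr rfl fun e he => ?_
  have hfilter : (X.filter fun v => D.fst e = v ∨ D.snd e = v) = X ∩ {D.fst e, D.snd e} := by grind
  rw [hfilter]
  have hne := hH e he
  by_cases h₁ : D.fst e ∈ X <;> by_cases h₂ : D.snd e ∈ X <;>
    simp [Finset.inter_insert_of_mem, Finset.inter_insert_of_notMem, h₁, h₂, hne]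

end Basic

section Sparse

variable {α β : Type*} [DecidableEq α] (D : Ends α β)

/-- The count `|H[Y]| ≤ 2|Y| - 2` for all nonempty `Y`, which says that `H` is independent in the
union of two copies of the cycle matroid. -/
def Sparse (H : Finset β) : Prop :=
  ∀ Y : Finset α, Y.Nonempty → (D.inside H Y).card + 2 ≤ 2 * Y.card

/-- A nonempty vertex set inside which a sparse edge set has as many edges as it may have. -/
def Tight (H : Finset β) (Y : Finset α) : Prop := Y.Nonempty ∧ 2 * Y.card ≤ (D.inside H Y).card + 2

variable {D} {H H' : Finset β} {V X Y : Finset α} {e : β} {x y : α}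

theorem sparse_empty : D.Sparse ∅ := by
  intro Y hY
  have := hY.card_pos
  simp only [inside, Finset.filter_empty, Finset.card_empty]
  lia

theorem Sparse.mono (hH' : D.Sparse H') (hH : H ⊆ H') : D.Sparse H := fun Y hY =>
  (Nat.add_le_add_right (Finset.card_le_card (inside_mono hH subset_rfl)) 2).trans (hH' Y hY)

theorem Sparse.loopless (hH : D.Sparse H) : D.Loopless H := by
  intro e he hloop
  have hsparse := hH {D.fst e} (Finset.singleton_nonempty _)
  have hpos : 0 < (D.inside H {D.fst e}).card :=
    Finset.card_pos.2 ⟨e, mem_inside.2 ⟨he, by simp [hloop]⟩⟩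
  rw [Finset.card_singleton] at hsparse
  lia

theorem tight_singleton (H : Finset β) (x : α) : D.Tight H {x} :=
  ⟨Finset.singleton_nonempty x, by simp⟩

theorem Tight.mono (hX : D.Tight H X) (hH : H ⊆ H') : D.Tight H' X :=
  ⟨hX.1, hX.2.trans (Nat.add_le_add_right (Finset.card_le_card (inside_mono hH subset_rfl)) 2)⟩

theorem Tight.congr (hX : D.Tight H X) (h : D.inside H X = D.inside H' X) : D.Tight H' X :=
  ⟨hX.1, h ▸ hX.2⟩

theorem Sparse.card_inside_eq (hH : D.Sparse H) (hX : D.Tight H X) :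
    (D.inside H X).card + 2 = 2 * X.card :=
  (hH X hX.1).antisymm hX.2

theorem Tight.union_and_inter (hH : D.Sparse H) (hX : D.Tight H X) (hY : D.Tight H Y)
    (hXY : (X ∩ Y).Nonempty) : D.Tight H (X ∪ Y) ∧ D.Tight H (X ∩ Y) := by
  have hunion : (X ∪ Y).Nonempty := hX.1.mono Finset.subset_union_left
  have hsuper := card_inside_add_card_inside_le (D := D) H X Y
  have hcard := Finset.card_union_add_card_inter X Y
  have := hH _ hXY
  have := hH _ hunion
  have := hX.2
  have := hY.2
  exact ⟨⟨hunion, by lia⟩, ⟨hXY, by lia⟩⟩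

theorem Tight.union (hH : D.Sparse H) (hX : D.Tight H X) (hY : D.Tight H Y) (hxX : x ∈ X)
    (hxY : x ∈ Y) : D.Tight H (X ∪ Y) :=
  (hX.union_and_inter hH hY ⟨x, Finset.mem_inter.2 ⟨hxX, hxY⟩⟩).1

theorem Tight.inter (hH : D.Sparse H) (hX : D.Tight H X) (hY : D.Tight H Y) (hxX : x ∈ X)
    (hxY : x ∈ Y) : D.Tight H (X ∩ Y) :=
  (hX.union_and_inter hH hY ⟨x, Finset.mem_inter.2 ⟨hxX, hxY⟩⟩).2

theorem Tight.inter_of_edgesIn (hX : D.Tight H X) (hH : D.EdgesIn H V) (hXV : (X ∩ V).Nonempty) :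
    D.Tight H (X ∩ V) := by
  have hinside : D.inside H X = D.inside H (X ∩ V) := by
    ext e
    have := hH e
    grind [mem_inside]
  have hcard : (X ∩ V).card ≤ X.card := Finset.card_le_card Finset.inter_subset_left
  have := hX.2
  rw [hinside] at this
  exact ⟨hXV, by lia⟩

theorem Sparse.tight_of_not_sparse_insert [DecidableEq β] (hH : D.Sparse H) (hY : Y.Nonempty)
    (hlt : 2 * Y.card < (D.inside (insert e H) Y).card + 2) :
    D.Tight H Y ∧ D.fst e ∈ Y ∧ D.snd e ∈ Y := by
  have hsparse := hH Y hY
  by_cases he : D.fst e ∈ Y ∧ D.snd e ∈ Y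
  · have hsub : D.inside (insert e H) Y ⊆ insert e (D.inside H Y) := by grind [mem_inside]
    have := (Finset.card_le_card hsub).trans (Finset.card_insert_le _ _)
    exact ⟨⟨hY, by lia⟩, he⟩
  · have hsub : D.inside (insert e H) Y ⊆ D.inside H Y := by grind [mem_inside]
    have := Finset.card_le_card hsub
    lia

theorem Sparse.exists_least_tight (hH : D.Sparse H) (hV : D.Tight H V) (hx : x ∈ V) (hy : y ∈ V) :
    ∃ Y ⊆ V, D.Tight H Y ∧ x ∈ Y ∧ y ∈ Y ∧ ∀ Z, D.Tight H Z → x ∈ Z → y ∈ Z → Y ⊆ Z := by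
  classical
  let F := V.powerset.filter fun Y => D.Tight H Y ∧ x ∈ Y ∧ y ∈ Y
  have hF : F.Nonempty := ⟨V, by simp [F, hV, hx, hy]⟩
  obtain ⟨Y, hYF, hmin⟩ := F.exists_min_image Finset.card hF
  simp only [F, Finset.mem_filter, Finset.mem_powerset] at hYF hmin
  obtain ⟨hYV, hY, hxY, hyY⟩ := hYF
  refine ⟨Y, hYV, hY, hxY, hyY, fun Z hZ hxZ hyZ => Finset.inter_eq_left.1 ?_⟩
  exact Finset.eq_of_subset_of_card_le Finset.inter_subset_left (hmin (Y ∩ Z)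
    ⟨Finset.inter_subset_left.trans hYV, hY.inter hH hZ hxY hxZ, by simp [*], by simp [*]⟩)

theorem Tight.star_inside_nonempty (hH : D.Sparse H) (hY : D.Tight H Y) (hx : x ∈ Y) (hy : y ∈ Y)
    (hxy : x ≠ y) : (D.star (D.inside H Y) x).Nonempty := by
  by_contra! hempty
  have hsub : D.inside H Y ⊆ D.inside H (Y.erase x) := by
    intro f hf
    have : f ∉ D.star (D.inside H Y) x := by simp [hempty]
    grind [mem_inside, mem_star]
  have := Finset.card_le_card hsub
  have := hH (Y.erase x) ⟨y, by simp [hy, hxy.symm]⟩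
  have := Finset.card_erase_add_one hx
  have := hY.2
  lia

end Sparse

section Rearrangement

variable {α β : Type*} [DecidableEq α] (D : Ends α β)

/-- The sparse edge sets `H` and `H'`, for both of which `Y` is tight, differ only in edges with
both ends in `Y`. Such a local change preserves the tight sets containing `Y` and the degrees
outside `Y`. -/
structure Rearrangement (Y : Finset α) (H H' : Finset β) : Prop where
  sparse_left : D.Sparse H
  sparse_right : D.Sparse H'
  tight_left : D.Tight H Y
  tight_right : D.Tight H' Y
  mem_iff : ∀ e, ¬(D.fst e ∈ Y ∧ D.snd e ∈ Y) → (e ∈ H ↔ e ∈ H')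

variable {D} {H H' H'' N HP HQ : Finset β} {P Q Y Z : Finset α} {v : α}

theorem card_inside_eq_of_agree (hYZ : Y ⊆ Z) (hY : (D.inside H Y).card = (D.inside H' Y).card)
    (h : ∀ e, ¬(D.fst e ∈ Y ∧ D.snd e ∈ Y) → (e ∈ H ↔ e ∈ H')) :
    (D.inside H Z).card = (D.inside H' Z).card := by
  have split : ∀ K : Finset β, (D.inside K Z).card = (D.inside K Y).card +
      ((D.inside K Z).filter fun e => ¬(D.fst e ∈ Y ∧ D.snd e ∈ Y)).card := by
    intro K
    rw [← Finset.card_filter_add_card_filter_not (fun e => D.fst e ∈ Y ∧ D.snd e ∈ Y)]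
    congr 2
    grind [mem_inside]
  have hrest : ((D.inside H Z).filter fun e => ¬(D.fst e ∈ Y ∧ D.snd e ∈ Y)) =
      (D.inside H' Z).filter fun e => ¬(D.fst e ∈ Y ∧ D.snd e ∈ Y) := by
    ext e
    have := h e
    grind [mem_inside]
  rw [split H, split H', hrest, hY]

theorem rearrangement_refl (hH : D.Sparse H) (hY : D.Tight H Y) : D.Rearrangement Y H H :=
  ⟨hH, hH, hY, hY, fun _ _ => Iff.rfl⟩

namespace Rearrangement

theorem symm (h : D.Rearrangement Y H H') : D.Rearrangement Y H' H :=
  ⟨h.sparse_right, h.sparse_left, h.tight_right, h.tight_left, fun e he => (h.mem_iff e he).symm⟩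

theorem trans (h : D.Rearrangement Y H H') (h' : D.Rearrangement Y H' H'') :
    D.Rearrangement Y H H'' :=
  ⟨h.sparse_left, h'.sparse_right, h.tight_left, h'.tight_right,
    fun e he => (h.mem_iff e he).trans (h'.mem_iff e he)⟩

theorem card_inside_eq (h : D.Rearrangement Y H H') (hYZ : Y ⊆ Z) :
    (D.inside H Z).card = (D.inside H' Z).card := by
  refine card_inside_eq_of_agree hYZ ?_ h.mem_iff
  have := h.sparse_left.card_inside_eq h.tight_left
  have := h.sparse_right.card_inside_eq h.tight_right
  lia

theorem tight (h : D.Rearrangement Y H H') (hYZ : Y ⊆ Z) (hZ : D.Tight H Z) : D.Tight H' Z :=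
  ⟨hZ.1, h.card_inside_eq hYZ ▸ hZ.2⟩

theorem mono (h : D.Rearrangement Y H H') (hYZ : Y ⊆ Z) (hZ : D.Tight H Z) :
    D.Rearrangement Z H H' :=
  ⟨h.sparse_left, h.sparse_right, hZ, h.tight hYZ hZ, fun e he => h.mem_iff e (by grind)⟩

theorem tight_of_disjoint (h : D.Rearrangement Y H H') (hYZ : Disjoint Y Z) (hZ : D.Tight H Z) :
    D.Tight H' Z := by
  refine hZ.congr ?_
  ext e
  have := h.mem_iff e
  grind [mem_inside, Finset.disjoint_left]

theorem deg_eq (h : D.Rearrangement Y H H') (hv : v ∉ Y) : D.deg H v = D.deg H' v := by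
  refine congrArg Finset.card (Finset.ext fun e => ?_)
  have := h.mem_iff e
  grind [mem_star]

end Rearrangement

theorem Sparse.rearrangement_replace [DecidableEq β] (hH : D.Sparse H) (hY : D.Tight H Y)
    (hN : D.Sparse N) (hNY : D.Tight N Y) :
    D.Rearrangement Y H
      (H.filter (fun e => ¬(D.fst e ∈ Y ∧ D.snd e ∈ Y)) ∪ D.inside N Y) := by
  set K := H.filter (fun e => ¬(D.fst e ∈ Y ∧ D.snd e ∈ Y)) ∪ D.inside N Y
  have mem_iff : ∀ e, ¬(D.fst e ∈ Y ∧ D.snd e ∈ Y) → (e ∈ H ↔ e ∈ K) := by grind [mem_inside]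
  have inside_eq : ∀ Z ⊆ Y, D.inside K Z = D.inside N Z := by grind [mem_inside]
  have hKY : D.Tight K Y := hNY.congr (inside_eq Y subset_rfl).symm
  refine ⟨hH, fun Z hZ => ?_, hY, hKY, mem_iff⟩
  rcases (Z ∩ Y).eq_empty_or_nonempty with hempty | hmeet
  · have : D.inside K Z ⊆ D.inside H Z := by
      intro e
      have := mem_iff e
      have hfst : D.fst e ∉ Z ∩ Y := by simp [hempty]
      grind [mem_inside]
    exact (Nat.add_le_add_right (Finset.card_le_card this) 2).trans (hH Z hZ)
  -- The number of edges inside `Z ∪ Y` does not change, so supermodularity gives the bound for `Z`.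
  · have hsuper := card_inside_add_card_inside_le (D := D) K Z Y
    have hY_eq : (D.inside H Y).card = (D.inside K Y).card := by
      have := hH.card_inside_eq hY
      have := hN.card_inside_eq hNY
      rw [inside_eq Y subset_rfl]
      lia
    have hunion := card_inside_eq_of_agree (Finset.subset_union_right (s₁ := Z)) hY_eq mem_iff
    rw [inside_eq _ Finset.inter_subset_right] at hsuper
    have := hH (Z ∪ Y) (hZ.mono Finset.subset_union_left)
    have := hN (Z ∩ Y) hmeet
    have := hKY.2
    have := Finset.card_union_add_card_inter Z Y
    lia

theorem Rearrangement.glue [DecidableEq β] (hPQ : Disjoint P Q) (hP : D.Rearrangement P H HP)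
    (hQ : D.Rearrangement Q H HQ) :
    ∃ K ⊆ HP ∪ HQ, D.Rearrangement Q HP K ∧ D.Rearrangement P HQ K := by
  have hQP : D.Tight HP Q := hP.tight_of_disjoint hPQ hQ.tight_left
  have hR := hP.sparse_right.rearrangement_replace hQP hQ.sparse_right hQ.tight_right
  refine ⟨_, Finset.union_subset_union (Finset.filter_subset _ _) (Finset.filter_subset _ _), hR,
    hQ.sparse_right, hR.sparse_right, hQ.tight_of_disjoint hPQ.symm hP.tight_left,
    hR.tight_of_disjoint hPQ.symm hP.tight_right, fun e he => ?_⟩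
  have := hP.mem_iff e he
  have := hQ.mem_iff e
  grind [mem_inside]

end Rearrangement

section Exchange

variable {α β : Type*} [DecidableEq α] {D : Ends α β} {E H HP HQ K : Finset β} {P Q W Y : Finset α}
  {e f : β} {h : α → ℕ} {v x : α}

theorem deg_insert_le [DecidableEq β] : D.deg (insert e K) v ≤ D.deg K v + 1 := by
  refine (Finset.card_le_card (t := insert e (D.star K v)) ?_).trans (Finset.card_insert_le _ _)
  grind [mem_star]

theorem deg_insert [DecidableEq β] (hfst : v ≠ D.fst e) (hsnd : v ≠ D.snd e) :
    D.deg (insert e K) v = D.deg K v := by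
  refine congrArg Finset.card (Finset.ext fun g => ?_)
  grind [mem_star]

theorem deg_erase_lt [DecidableEq β] (hf : f ∈ D.star K v) : D.deg (K.erase f) v < D.deg K v := by
  refine Finset.card_lt_card ((Finset.ssubset_iff_of_subset ?_).2 ⟨f, hf, ?_⟩) <;> grind [mem_star]

theorem Sparse.swap [DecidableEq β] (hK : D.Sparse K) (hP : D.Tight K P) (hQ : D.Tight K Q)
    (heP : D.fst e ∈ P) (heQ : D.snd e ∈ Q) (hfP : f ∉ D.inside K P) (hfQ : f ∉ D.inside K Q)
    (hall : ∀ Z, D.Tight K Z → P ⊆ Z → Q ⊆ Z → f ∈ D.inside K Z) :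
    D.Sparse (insert e (K.erase f)) := by
  intro Z hZ
  by_contra! hlt
  have hK' : D.Sparse (K.erase f) := hK.mono (Finset.erase_subset _ _)
  obtain ⟨hZ', heZ, heZ'⟩ := hK'.tight_of_not_sparse_insert hZ hlt
  have tight_erase : ∀ Y, D.Tight K Y → f ∉ D.inside K Y → D.Tight (K.erase f) Y :=
    fun Y hY hfY => hY.congr (by grind [mem_inside])
  have hZP := hZ'.union hK' (tight_erase P hP hfP) heZ heP
  have hW := hZP.union hK' (tight_erase Q hQ hfQ) (Finset.mem_union_left _ heZ') heQ
  set W := Z ∪ P ∪ Q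
  have hfW : f ∈ D.inside K W :=
    hall W (hW.mono (Finset.erase_subset _ _)) (by grind) (by grind)
  have hlt : (D.inside (K.erase f) W).card < (D.inside K W).card :=
    Finset.card_lt_card ((Finset.ssubset_iff_of_subset
      (inside_mono (Finset.erase_subset _ _) subset_rfl)).2 ⟨f, hfW, by simp [mem_inside]⟩)
  have := hK W hW.1
  have := hW.2
  lia

theorem Sparse.rearrangement_swap [DecidableEq β] (hK : D.Sparse K)
    (hK' : D.Sparse (insert e (K.erase f))) (hW : D.Tight K W) (heK : e ∉ K) (he : D.fst e ∈ W)
    (he' : D.snd e ∈ W) (hf : f ∈ D.inside K W) :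
    D.Rearrangement W K (insert e (K.erase f)) := by
  have hinside : D.inside (insert e (K.erase f)) W = insert e ((D.inside K W).erase f) := by
    grind [mem_inside]
  refine ⟨hK, hK', hW, ⟨hW.1, ?_⟩, fun g hg => ?_⟩
  · rw [hinside, Finset.card_insert_of_notMem (by grind [mem_inside]),
      Finset.card_erase_add_one hf]
    exact hW.2
  · grind [mem_inside]

theorem Rearrangement.exists_swap [DecidableEq β] (hP : D.Rearrangement P H HP)
    (hQ : D.Rearrangement Q H HQ) (hPK : D.Rearrangement P HQ K) (hQK : D.Rearrangement Q HP K)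
    (hPQ : Disjoint P Q) (heP : D.fst e ∈ P) (heQ : D.snd e ∈ Q) (heH : e ∉ H) (hY : D.Tight H Y)
    (heY : D.fst e ∈ Y) (heY' : D.snd e ∈ Y)
    (hleast : ∀ Z, D.Tight H Z → D.fst e ∈ Z → D.snd e ∈ Z → Y ⊆ Z) (hx : x ∈ Y) (hxP : x ∉ P)
    (hxQ : x ∉ Q) :
    ∃ f ∈ D.star K x, D.Rearrangement (Y ∪ P ∪ Q) H (insert e (K.erase f)) := by
  have hPQ' := Finset.disjoint_left.1 hPQ
  obtain ⟨f, hf⟩ := hY.star_inside_nonempty hP.sparse_left hx heY (by grind)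
  have hW : D.Tight H (Y ∪ P ∪ Q) :=
    (hY.union hP.sparse_left hP.tight_left heY heP).union hP.sparse_left hQ.tight_left
      (Finset.mem_union_left _ heY') heQ
  have hHK : D.Rearrangement (Y ∪ P ∪ Q) H K :=
    (hQ.mono (by grind) hW).trans (hPK.mono (by grind) (hQ.tight (by grind) hW))
  have agree : ∀ g, ¬(D.fst g ∈ P ∧ D.snd g ∈ P) → ¬(D.fst g ∈ Q ∧ D.snd g ∈ Q) →
      (g ∈ H ↔ g ∈ K) := fun g hgP hgQ => (hP.mem_iff g hgP).trans (hQK.mem_iff g hgQ)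
  have hfK : f ∈ K := by grind [mem_inside, mem_star]
  have heK : e ∉ K := by grind
  have hK' : D.Sparse (insert e (K.erase f)) := by
    refine hHK.sparse_right.swap hPK.tight_right hQK.tight_right heP heQ
      (by grind [mem_inside, mem_star]) (by grind [mem_inside, mem_star]) fun Z hZ hPZ hQZ => ?_
    have := hleast Z (hQ.symm.tight hQZ (hPK.symm.tight hPZ hZ)) (hPZ heP) (hQZ heQ)
    grind [mem_inside, mem_star]
  refine ⟨f, by grind [mem_star], hHK.trans ?_⟩
  exact hHK.sparse_right.rearrangement_swap hK' hHK.tight_right heK (by grind) (by grind)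
    (by grind [mem_inside, mem_star])

variable (D) in
/-- The sparse edge set `H` can be changed inside its tight set `Y`, using edges of `E`, so that
the degree bound `h` holds on `Y` and leaves room for one more edge at the vertex `x` of `Y`. -/
def Relaxation (E H : Finset β) (h : α → ℕ) (x : α) (Y : Finset α) : Prop :=
  x ∈ Y ∧ ∃ H' ⊆ E, D.Rearrangement Y H H' ∧ D.deg H' x < h x ∧ ∀ v ∈ Y, D.deg H' v ≤ h v

/-- After the relaxations inside `P` and `Q` the edge `e` can be added in exchange for an edge of
`H` at `x`. -/
theorem Relaxation.exchange (he : e ∈ E) (heH : e ∉ H)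
    (hP : D.Relaxation E H h (D.fst e) P) (hQ : D.Relaxation E H h (D.snd e) Q)
    (hPQ : Disjoint P Q) (hY : D.Tight H Y) (heY : D.fst e ∈ Y) (heY' : D.snd e ∈ Y)
    (hleast : ∀ Z, D.Tight H Z → D.fst e ∈ Z → D.snd e ∈ Z → Y ⊆ Z) (hx : x ∈ Y) (hxP : x ∉ P)
    (hxQ : x ∉ Q) :
    ∃ H' ⊆ E, D.Rearrangement (Y ∪ (P ∪ Q)) H H' ∧ D.deg H' x < D.deg H x ∧
      (∀ v ∈ P ∪ Q, D.deg H' v ≤ h v) ∧ ∀ v ∉ P ∪ Q, D.deg H' v ≤ D.deg H v := by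
  classical
  obtain ⟨heP, HP, hPE, hP, hPlt, hPle⟩ := hP
  obtain ⟨heQ, HQ, hQE, hQ, hQlt, hQle⟩ := hQ
  obtain ⟨K, hKsub, hQK, hPK⟩ := hP.glue hPQ hQ
  obtain ⟨f, hf, hswap⟩ :=
    hP.exists_swap hQ hPK hQK hPQ heP heQ heH hY heY heY' hleast hx hxP hxQ
  rw [Finset.union_assoc] at hswap
  have hPQ' := Finset.disjoint_left.1 hPQ
  have deg_P : ∀ v ∈ P, D.deg K v = D.deg HP v := fun v hv => (hQK.deg_eq (hPQ' hv)).symm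
  have deg_Q : ∀ v ∈ Q, D.deg K v = D.deg HQ v := fun v hv =>
    (hPK.deg_eq fun hvP => hPQ' hvP hv).symm
  have deg_off : ∀ v, v ∉ P → v ∉ Q → D.deg K v = D.deg H v := fun v hvP hvQ =>
    ((hP.deg_eq hvP).trans (hQK.deg_eq hvQ)).symm
  have deg_erase_le : ∀ v, D.deg (K.erase f) v ≤ D.deg K v := fun v =>
    deg_mono (Finset.erase_subset _ _) v
  have deg_swap_le : ∀ v, v ≠ D.fst e → v ≠ D.snd e →
      D.deg (insert e (K.erase f)) v ≤ D.deg K v := fun v h₁ h₂ =>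
    (deg_insert h₁ h₂).trans_le (deg_erase_le v)
  have deg_swap_le_succ : ∀ v, D.deg (insert e (K.erase f)) v ≤ D.deg K v + 1 := fun v =>
    deg_insert_le.trans (Nat.add_le_add_right (deg_erase_le v) 1)
  refine ⟨insert e (K.erase f), by grind, hswap, ?_, fun v hv => ?_, fun v hv => ?_⟩
  · rw [deg_insert (by grind) (by grind), ← deg_off x hxP hxQ]
    exact deg_erase_lt hf
  · rcases eq_or_ne v (D.fst e) with rfl | h₁
    · exact (deg_swap_le_succ _).trans (deg_P _ heP ▸ hPlt)
    rcases eq_or_ne v (D.snd e) with rfl | h₂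
    · exact (deg_swap_le_succ _).trans (deg_Q _ heQ ▸ hQlt)
    refine (deg_swap_le v h₁ h₂).trans ?_
    rcases Finset.mem_union.1 hv with hvP | hvQ
    · exact (deg_P v hvP).trans_le (hPle v hvP)
    · exact (deg_Q v hvQ).trans_le (hQle v hvQ)
  · rw [Finset.notMem_union] at hv
    exact (deg_swap_le v (by grind) (by grind)).trans_eq (deg_off v hv.1 hv.2)

end Exchange

section TightPartition

variable {α β : Type*} [DecidableEq α] {D : Ends α β} {E F H : Finset β} {R V : Finset α}
  {k : ℕ}

theorem sum_card_inside [DecidableEq β] (P : Finpartition R) (F : Finset β) :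
    ∑ C ∈ P.parts, (D.inside F C).card = (P.parts.biUnion (D.inside F)).card := by
  refine (Finset.card_biUnion fun C hC C' hC' hne => ?_).symm
  have := Finset.disjoint_left.1 (P.disjoint hC hC' hne)
  rw [Function.onFun, Finset.disjoint_left]
  grind [mem_inside]

theorem sum_card_inside_le (P : Finpartition R) (F : Finset β) :
    ∑ C ∈ P.parts, (D.inside F C).card ≤ (D.inside F R).card := by
  classical
  rw [sum_card_inside]
  exact Finset.card_le_card (Finset.biUnion_subset.2 fun C hC =>
    inside_mono subset_rfl (P.subset hC))

theorem card_inside_le_sum (P : Finpartition R)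
    (hF : ∀ e ∈ D.inside F R, ∃ C ∈ P.parts, e ∈ D.inside F C) :
    (D.inside F R).card ≤ ∑ C ∈ P.parts, (D.inside F C).card := by
  classical
  rw [sum_card_inside]
  exact Finset.card_le_card fun e he => Finset.mem_biUnion.2 (hF e he)

theorem Loopless.sum_card_cut (hF : D.Loopless F) (P : Finpartition R) :
    ∑ C ∈ P.parts, ((D.cut F C).card + 2 * (D.inside F C).card) =
      (D.cut F R).card + 2 * (D.inside F R).card := by
  have hsum := Finset.sum_biUnion (f := D.deg F) P.disjoint
  rw [P.biUnion_parts, hF.sum_deg] at hsum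
  rw [hsum]
  exact Finset.sum_congr rfl fun C _ => (hF.sum_deg C).symm

theorem card_inside_add_card_inside_sdiff [DecidableEq β] (hHE : H ⊆ E) (Y : Finset α) :
    (D.inside H Y).card + (D.inside (E \ H) Y).card = (D.inside E Y).card := by
  rw [← Finset.card_union_of_disjoint (by rw [Finset.disjoint_left]; grind [mem_inside])]
  congr 1
  grind [mem_inside]

theorem Sparse.exists_finpartition (hH : D.Sparse H) (R : Finset α) :
    ∃ P : Finpartition R, (∀ C ∈ P.parts, D.Tight H C) ∧
      ∀ Z ⊆ R, D.Tight H Z → ∃ C ∈ P.parts, Z ⊆ C := by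
  classical
  let F := R.powerset.filter (D.Tight H)
  have mem_F : ∀ {C}, C ∈ F ↔ C ⊆ R ∧ D.Tight H C := by simp [F]
  have exists_le : ∀ Z ⊆ R, D.Tight H Z → ∃ C ∈ F.filter (Maximal (· ∈ F)), Z ⊆ C := by
    intro Z hZR hZ
    obtain ⟨C, hZC, hC⟩ := F.exists_le_maximal (mem_F.2 ⟨hZR, hZ⟩)
    exact ⟨C, Finset.mem_filter.2 ⟨hC.prop, hC⟩, hZC⟩
  refine ⟨Finpartition.ofExistsUnique (F.filter (Maximal (· ∈ F))) (fun C hC => ?_)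
    (fun y hy => ?_) fun hempty => ?_, fun C hC => ?_, exists_le⟩
  · exact (mem_F.1 (Finset.mem_filter.1 hC).1).1
  · obtain ⟨C, hC, hyC⟩ := exists_le {y} (by simpa using hy) (tight_singleton H y)
    have hyC : y ∈ C := Finset.singleton_subset_iff.1 hyC
    refine ⟨C, ⟨hC, hyC⟩, fun C' ⟨hC', hyC'⟩ => ?_⟩
    obtain ⟨hCF, hCmax⟩ := Finset.mem_filter.1 hC
    obtain ⟨hCF', hCmax'⟩ := Finset.mem_filter.1 hC'
    obtain ⟨hCR, hC⟩ := mem_F.1 hCF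
    obtain ⟨hCR', hC'⟩ := mem_F.1 hCF'
    have hunion : C ∪ C' ∈ F := mem_F.2 ⟨Finset.union_subset hCR hCR', hC.union hH hC' hyC hyC'⟩
    exact (hCmax'.eq_of_le hunion Finset.subset_union_right).trans
      (hCmax.eq_of_le hunion Finset.subset_union_left).symm
  · exact (mem_F.1 (Finset.mem_filter.1 hempty).1).2.1.ne_empty rfl
  · exact (mem_F.1 (Finset.mem_filter.1 hC).1).2

/-- Double counting of the edges of `E` leaving the classes of the partition of `R` into the
maximal tight sets of `H`, of which there are `p`. -/
theorem Sparse.exists_count [DecidableEq β] (hH : D.Sparse H) (hHE : H ⊆ E) (hE : D.Loopless E)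
    (hRV : R ⊆ V) (hcut : D.CutsAtLeast k E V) (hV : R = V → ¬D.Tight H V)
    (hclosed : ∀ e ∈ D.inside (E \ H) R, ∃ Z ⊆ R, D.Tight H Z ∧ e ∈ D.inside (E \ H) Z) :
    ∃ p, 2 * R.card ≤ (D.inside H R).card + 2 * p ∧
      k * p + 4 * R.card ≤ (D.cut E R).card + 2 * (D.inside H R).card + 4 * p := by
  obtain ⟨P, hP, hPmax⟩ := hH.exists_finpartition R
  have hrest : (D.inside (E \ H) R).card ≤ ∑ C ∈ P.parts, (D.inside (E \ H) C).card := by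
    refine card_inside_le_sum P fun e he => ?_
    obtain ⟨Z, hZR, hZ, heZ⟩ := hclosed e he
    obtain ⟨C, hC, hZC⟩ := hPmax Z hZR hZ
    exact ⟨C, hC, inside_mono subset_rfl hZC heZ⟩
  have htight : ∑ C ∈ P.parts, ((D.inside H C).card + 2) = ∑ C ∈ P.parts, 2 * C.card :=
    Finset.sum_congr rfl fun C hC => hH.card_inside_eq (hP C hC)
  have hsplit : ∑ C ∈ P.parts, ((D.inside H C).card + (D.inside (E \ H) C).card) =
      ∑ C ∈ P.parts, (D.inside E C).card :=
    Finset.sum_congr rfl fun C _ => card_inside_add_card_inside_sdiff hHE C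
  have hcuts : ∑ _C ∈ P.parts, k ≤ ∑ C ∈ P.parts, (D.cut E C).card := by
    refine Finset.sum_le_sum fun C hC => hcut C ((P.subset hC).trans hRV) (hP C hC).1 fun hCV => ?_
    exact hV (hRV.antisymm (hCV ▸ P.subset hC)) (hCV ▸ hP C hC)
  have hdeg := hE.sum_card_cut P
  have hHR := sum_card_inside_le (D := D) P H
  have hER := card_inside_add_card_inside_sdiff (D := D) hHE R
  simp only [Finset.sum_add_distrib, ← Finset.mul_sum, P.sum_card_parts, Finset.sum_const,
    smul_eq_mul] at htight hsplit hcuts hdeg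
  rw [mul_comm] at hcuts
  exact ⟨P.parts.card, by lia, by lia⟩

theorem exists_sparse_tight (hk : 4 ≤ k) (hne : V.Nonempty) (hE : D.EdgesIn E V)
    (hloop : D.Loopless E) (hcut : D.CutsAtLeast k E V) :
    ∃ H ⊆ E, D.Sparse H ∧ D.Tight H V := by
  classical
  let F := E.powerset.filter D.Sparse
  have mem_F : ∀ {H}, H ∈ F ↔ H ⊆ E ∧ D.Sparse H := by simp [F]
  obtain ⟨H, -, hH⟩ := F.exists_le_maximal (mem_F.2 ⟨Finset.empty_subset E, sparse_empty⟩)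
  obtain ⟨hHE, hsparse⟩ := mem_F.1 hH.prop
  refine ⟨H, hHE, hsparse, ?_⟩
  by_contra hV
  have hclosed : ∀ e ∈ D.inside (E \ H) V, ∃ Z ⊆ V, D.Tight H Z ∧ e ∈ D.inside (E \ H) Z := by
    intro e he
    have heE : e ∈ E ∧ e ∉ H := Finset.mem_sdiff.1 (mem_inside.1 he).1
    have hinsert : ¬D.Sparse (insert e H) := fun hsp => heE.2
      (hH.le_of_ge (mem_F.2 ⟨Finset.insert_subset heE.1 hHE, hsp⟩) (Finset.subset_insert e H)
        (Finset.mem_insert_self e H))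
    simp only [Sparse, not_forall, not_le] at hinsert
    obtain ⟨Y, hY, hlt⟩ := hinsert
    obtain ⟨hY, heY⟩ := hsparse.tight_of_not_sparse_insert hY hlt
    have heYV : e ∈ D.inside (E \ H) (Y ∩ V) := by grind [mem_inside]
    exact ⟨Y ∩ V, Finset.inter_subset_right,
      hY.inter_of_edgesIn (hE.mono hHE) ⟨D.fst e, (mem_inside.1 heYV).2.1⟩, heYV⟩
  obtain ⟨p, -, hcount⟩ :=
    hsparse.exists_count hHE hloop subset_rfl hcut (fun _ => hV) hclosed
  rw [hE.cut_eq_empty, Finset.card_empty] at hcount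
  have hlt : ¬2 * V.card ≤ (D.inside H V).card + 2 := fun h => hV ⟨hne, h⟩
  have := Nat.mul_le_mul_right p hk
  lia

end TightPartition

section DegreeBound

variable {α β : Type*} [DecidableEq α] {D : Ends α β} {E H H' : Finset β} {A B R S V Y : Finset α}
  {e : β} {h : α → ℕ} {k : ℕ} {x : α}

variable (D) in
/-- Among the sparse subsets of `E` for which `V` is tight, `H` exceeds the degree bound `h` on `V`
by the least total amount, where the truncated subtraction disregards the vertices below the
bound. -/
structure LeastExcess (E : Finset β) (V : Finset α) (h : α → ℕ) (H : Finset β) : Prop where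
  subset : H ⊆ E
  sparse : D.Sparse H
  tight : D.Tight H V
  least : ∀ H' ⊆ E, D.Sparse H' → D.Tight H' V →
    ∑ v ∈ V, (D.deg H v - h v) ≤ ∑ v ∈ V, (D.deg H' v - h v)

theorem exists_leastExcess (hH : ∃ H ⊆ E, D.Sparse H ∧ D.Tight H V) (h : α → ℕ) :
    ∃ H, D.LeastExcess E V h H := by
  classical
  let F := E.powerset.filter fun H => D.Sparse H ∧ D.Tight H V
  have hF : F.Nonempty := by
    obtain ⟨H, hHE, hH⟩ := hH
    exact ⟨H, by simp [F, hHE, hH]⟩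
  obtain ⟨H, hHF, hmin⟩ := F.exists_min_image (fun H => ∑ v ∈ V, (D.deg H v - h v)) hF
  simp only [F, Finset.mem_filter, Finset.mem_powerset] at hHF hmin
  exact ⟨H, hHF.1, hHF.2.1, hHF.2.2, fun H' hE hsparse htight => hmin H' ⟨hE, hsparse, htight⟩⟩

theorem LeastExcess.deg_le_of_rearrangement (hH : D.LeastExcess E V h H) (hYV : Y ⊆ V)
    (hR : D.Rearrangement Y H H') (hH' : H' ⊆ E) (hle : ∀ v, D.deg H' v ≤ max (D.deg H v) (h v))
    (hx : x ∈ V) (hlt : D.deg H' x < D.deg H x) : D.deg H x ≤ h x := by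
  by_contra! hbad
  refine absurd (hH.least H' hH' hR.sparse_right (hR.tight hYV hH.tight)) (not_le.2 ?_)
  exact Finset.sum_lt_sum (fun v _ => by grind) ⟨x, hx, by lia⟩

variable (D) in
/-- Every vertex of `R` can be relaxed inside `R`. -/
def Relaxing (E H : Finset β) (h : α → ℕ) (R : Finset α) : Prop :=
  ∀ x ∈ R, ∃ Y ⊆ R, D.Relaxation E H h x Y

theorem Relaxing.union (hA : D.Relaxing E H h A) (hB : D.Relaxing E H h B) :
    D.Relaxing E H h (A ∪ B) := by
  intro x hx
  rcases Finset.mem_union.1 hx with hxA | hxB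
  · obtain ⟨Y, hY, hr⟩ := hA x hxA
    exact ⟨Y, hY.trans Finset.subset_union_left, hr⟩
  · obtain ⟨Y, hY, hr⟩ := hB x hxB
    exact ⟨Y, hY.trans Finset.subset_union_right, hr⟩

theorem relaxing_singleton (hHE : H ⊆ E) (hH : D.Sparse H) (hx : D.deg H x < h x) :
    D.Relaxing E H h {x} := by
  simp only [Relaxing, Finset.mem_singleton, forall_eq]
  refine ⟨{x}, subset_rfl, Finset.mem_singleton_self x, H, hHE,
    rearrangement_refl hH (tight_singleton H x), hx, ?_⟩
  simpa using hx.le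

theorem exists_greatest_relaxing (E H : Finset β) (h : α → ℕ) (V : Finset α) :
    ∃ R ⊆ V, D.Relaxing E H h R ∧ ∀ B ⊆ V, D.Relaxing E H h B → B ⊆ R := by
  classical
  let F := V.powerset.filter (D.Relaxing E H h)
  have mem_F : ∀ {R}, R ∈ F ↔ R ⊆ V ∧ D.Relaxing E H h R := by simp [F]
  obtain ⟨R, -, hR⟩ := F.exists_le_maximal (mem_F.2 ⟨Finset.empty_subset V, by simp [Relaxing]⟩)
  obtain ⟨hRV, hrel⟩ := mem_F.1 hR.prop
  refine ⟨R, hRV, hrel, fun B hB hrelB => (Finset.subset_union_right (s₁ := R)).trans ?_⟩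
  exact hR.le_of_ge (mem_F.2 ⟨Finset.union_subset hRV hB, hrel.union hrelB⟩)
    Finset.subset_union_left

theorem LeastExcess.deg_le_of_relaxing (hH : D.LeastExcess E V h H) (hRV : R ⊆ V)
    (hR : D.Relaxing E H h R) (hx : x ∈ R) : D.deg H x ≤ h x := by
  obtain ⟨Y, hYR, -, H', hH'E, hYH, hlt, hle⟩ := hR x hx
  by_contra! hbad
  refine absurd (hH.deg_le_of_rearrangement (hYR.trans hRV) hYH hH'E (fun v => ?_) (hRV hx)
    (by lia)) (not_le.2 hbad)
  by_cases hv : v ∈ Y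
  · exact le_max_of_le_right (hle v hv)
  · exact le_max_of_le_left (hYH.deg_eq hv).ge

theorem LeastExcess.relaxing_union_of_exchange (hH : D.LeastExcess E V h H) (hRV : R ⊆ V)
    (hR : D.Relaxing E H h R) (hYV : Y ⊆ V) (hSR : S ⊆ R)
    (hexch : ∀ x ∈ Y, x ∉ R → ∃ H' ⊆ E, D.Rearrangement (Y ∪ S) H H' ∧ D.deg H' x < D.deg H x ∧
      (∀ v ∈ S, D.deg H' v ≤ h v) ∧ ∀ v ∉ S, D.deg H' v ≤ D.deg H v) :
    D.Relaxing E H h (Y ∪ R) := by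
  have deg_le : ∀ x ∈ Y ∪ R, D.deg H x ≤ h x := by
    intro x hx
    by_cases hxR : x ∈ R
    · exact hH.deg_le_of_relaxing hRV hR hxR
    have hxY : x ∈ Y := (Finset.mem_union.1 hx).resolve_right hxR
    obtain ⟨H', hH'E, hW, hlt, hle, hle'⟩ := hexch x hxY hxR
    exact hH.deg_le_of_rearrangement (Finset.union_subset hYV (hSR.trans hRV)) hW hH'E
      (fun v => by grind) (hYV hxY) hlt
  intro x hx
  by_cases hxR : x ∈ R
  · obtain ⟨Z, hZ, hr⟩ := hR x hxR
    exact ⟨Z, hZ.trans Finset.subset_union_right, hr⟩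
  have hxY : x ∈ Y := (Finset.mem_union.1 hx).resolve_right hxR
  obtain ⟨H', hH'E, hW, hlt, hle, hle'⟩ := hexch x hxY hxR
  refine ⟨Y ∪ S, Finset.union_subset_union_right hSR, Finset.mem_union_left _ hxY, H', hH'E, hW,
    hlt.trans_le (deg_le x hx), ?_⟩
  grind

/-- Otherwise `e` could be exchanged for an edge at any vertex outside `R` of the least tight set
containing the ends of `e`, so that this set could be added to `R`. -/
theorem LeastExcess.exists_tight_subset [DecidableEq β] (hH : D.LeastExcess E V h H) (hRV : R ⊆ V)
    (hR : D.Relaxing E H h R) (hmax : ∀ B ⊆ V, D.Relaxing E H h B → B ⊆ R)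
    (he : e ∈ D.inside (E \ H) R) :
    ∃ Z ⊆ R, D.Tight H Z ∧ e ∈ D.inside (E \ H) Z := by
  obtain ⟨⟨heE, heH⟩, hfst, hsnd⟩ := by simpa only [mem_inside, Finset.mem_sdiff] using he
  by_contra! hno
  have hno : ∀ Z ⊆ R, D.Tight H Z → D.fst e ∈ Z → D.snd e ∉ Z := by grind [mem_inside]
  obtain ⟨P, hPR, hP⟩ := hR _ hfst
  obtain ⟨Q, hQR, hQ⟩ := hR _ hsnd
  have hPQ : Disjoint P Q := by
    rw [Finset.disjoint_left]
    obtain ⟨heP, _, -, hP, -⟩ := hP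
    obtain ⟨heQ, _, -, hQ, -⟩ := hQ
    exact fun v hvP hvQ => hno (P ∪ Q) (Finset.union_subset hPR hQR)
      (hP.tight_left.union hH.sparse hQ.tight_left hvP hvQ) (Finset.mem_union_left _ heP)
      (Finset.mem_union_right _ heQ)
  obtain ⟨Y, hYV, hY, hfstY, hsndY, hleast⟩ :=
    hH.sparse.exists_least_tight hH.tight (hRV hfst) (hRV hsnd)
  have hYR : D.Relaxing E H h (Y ∪ R) :=
    hH.relaxing_union_of_exchange hRV hR hYV (Finset.union_subset hPR hQR) fun x hx hxR =>
      hP.exchange heE heH hQ hPQ hY hfstY hsndY hleast hx (fun h' => hxR (hPR h'))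
        fun h' => hxR (hQR h')
  exact hno Y (Finset.subset_union_left.trans (hmax _ (Finset.union_subset hYV hRV) hYR)) hY hfstY
    hsndY

theorem Sparse.sum_deg_lt {p : ℕ} (hk : 4 ≤ k) (hH : D.Sparse H) (hHE : H ⊆ E)
    (hE : D.EdgesIn E V) (hloop : D.Loopless E) (hV : D.Tight H V) (hRV : R ⊆ V)
    (hne : (V \ R).Nonempty) (hp : 2 * R.card ≤ (D.inside H R).card + 2 * p)
    (hcount : k * p + 4 * R.card ≤ (D.cut E R).card + 2 * (D.inside H R).card + 4 * p) :
    k * ∑ v ∈ V \ R, D.deg H v + 8 * (V \ R).card <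
      2 * ∑ v ∈ V \ R, D.deg E v + 4 * k * (V \ R).card := by
  have hcard := (hE.mono hHE).card_eq (V \ R)
  have hinsideV := hH.card_inside_eq hV
  have hsparse := hH _ hne
  have hinside : (D.inside H (V \ R)).card ≤ (D.inside E (V \ R)).card :=
    Finset.card_le_card (inside_mono hHE subset_rfl)
  have hVR := Finset.card_sdiff_add_card_eq_card hRV
  rw [(hE.mono hHE).inside_eq] at hinsideV
  rw [Finset.sdiff_sdiff_eq_self hRV] at hcard
  rw [(hloop.mono hHE).sum_deg, hloop.sum_deg, hE.cut_sdiff]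
  obtain ⟨j, rfl⟩ := Nat.exists_eq_add_of_le hk
  have hj := Nat.mul_le_mul_left j hp
  have hj' := Nat.mul_le_mul_left j hsparse
  nlinarith

theorem exists_sparse_tight_deg_le (hk : 4 ≤ k) (hne : V.Nonempty) (hE : D.EdgesIn E V)
    (hloop : D.Loopless E) (hcut : D.CutsAtLeast k E V)
    (hh : ∀ v ∈ V, 2 * D.deg E v + 4 * k ≤ k * h v + 8) :
    ∃ H ⊆ E, D.Sparse H ∧ D.Tight H V ∧ ∀ v ∈ V, D.deg H v ≤ h v := by
  classical
  obtain ⟨H, hH⟩ := exists_leastExcess (exists_sparse_tight hk hne hE hloop hcut) h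
  refine ⟨H, hH.subset, hH.sparse, hH.tight, ?_⟩
  obtain ⟨R, hRV, hR, hmax⟩ := exists_greatest_relaxing (D := D) E H h V
  by_contra! ⟨b, hbV, hb⟩
  have hbR : b ∉ R := fun hbR => (hH.deg_le_of_relaxing hRV hR hbR).not_gt hb
  have le_deg : ∀ v ∈ V \ R, h v ≤ D.deg H v := by
    intro v hv
    obtain ⟨hvV, hvR⟩ := Finset.mem_sdiff.1 hv
    by_contra! hlt
    exact hvR (hmax {v} (Finset.singleton_subset_iff.2 hvV)
      (relaxing_singleton hH.subset hH.sparse hlt) (Finset.mem_singleton_self v))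
  obtain ⟨p, hp, hcount⟩ := hH.sparse.exists_count hH.subset hloop hRV hcut
    (fun hRV' => absurd hbV (hRV' ▸ hbR)) fun e he => hH.exists_tight_subset hRV hR hmax he
  have hlt := hH.sparse.sum_deg_lt hk hH.subset hE hloop hH.tight hRV
    ⟨b, Finset.mem_sdiff.2 ⟨hbV, hbR⟩⟩ hp hcount
  have hle : ∑ v ∈ V \ R, (2 * D.deg E v + 4 * k) ≤ ∑ v ∈ V \ R, (k * D.deg H v + 8) :=
    Finset.sum_le_sum fun v hv => (hh v (Finset.mem_sdiff.1 hv).1).trans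
      (Nat.add_le_add_right (Nat.mul_le_mul_left k (le_deg v hv)) 8)
  simp only [Finset.sum_add_distrib, ← Finset.mul_sum, Finset.sum_const, smul_eq_mul] at hle
  lia

end DegreeBound

section Reattach

variable {α β : Type*} [DecidableEq β] {D : Ends α β} {H : Finset β} {V : Finset α} {e f : β}
  {a b : α}

variable (D) in
/-- The multigraph with the edge `e` moved to the ends `a` and `b`. -/
def reattach (e : β) (a b : α) : Ends α β :=
  ⟨Function.update D.fst e a, Function.update D.snd e b⟩

theorem fst_reattach_self (e : β) (a b : α) : (D.reattach e a b).fst e = a :=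
  Function.update_self _ _ _

theorem snd_reattach_self (e : β) (a b : α) : (D.reattach e a b).snd e = b :=
  Function.update_self _ _ _

theorem fst_reattach (h : f ≠ e) : (D.reattach e a b).fst f = D.fst f :=
  Function.update_of_ne h _ _

theorem snd_reattach (h : f ≠ e) : (D.reattach e a b).snd f = D.snd f :=
  Function.update_of_ne h _ _

theorem links_reattach (e : β) (a b : α) : (D.reattach e a b).Links e a b :=
  .inl ⟨fst_reattach_self e a b, snd_reattach_self e a b⟩

theorem EdgesIn.reattach_insert (hH : D.EdgesIn H V) (ha : a ∈ V) (hb : b ∈ V) :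
    (D.reattach e a b).EdgesIn (insert e H) V := by
  intro f hf
  by_cases h : f = e
  · rw [h, fst_reattach_self, snd_reattach_self]
    exact ⟨ha, hb⟩
  · rw [fst_reattach h, snd_reattach h]
    exact hH f (Finset.mem_of_mem_insert_of_ne hf h)

end Reattach

section Connects

variable {α β : Type*} [DecidableEq α] (D : Ends α β)

/-- The edge set `T` connects the vertex set `V`: it meets every cut between two nonempty parts
of `V`. -/
def Connects (T : Finset β) (V : Finset α) : Prop :=
  ∀ X ⊆ V, X.Nonempty → X ≠ V → (D.cut T X).Nonempty

/-- `H` contains two disjoint edge sets that connect `V`, for example two disjoint spanning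
trees. -/
def DoublyConnects (H : Finset β) (V : Finset α) : Prop :=
  ∃ T₁ ⊆ H, ∃ T₂ ⊆ H, Disjoint T₁ T₂ ∧ D.Connects T₁ V ∧ D.Connects T₂ V

variable {D} {H T : Finset β} {V X Y : Finset α} {e f e₁ e₂ e₃ : β} {a b v w : α}

theorem exists_links (he : e ∈ D.star H v) : ∃ w, D.Links e v w := by
  rcases (mem_star.1 he).2 with h | h
  exacts [⟨_, .inl ⟨h, rfl⟩⟩, ⟨_, .inr ⟨rfl, h⟩⟩]

theorem Links.mem_cut_iff (h : D.Links e a b) : e ∈ D.cut H X ↔ e ∈ H ∧ ¬(a ∈ X ↔ b ∈ X) := by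
  rcases h with ⟨rfl, rfl⟩ | ⟨rfl, rfl⟩ <;> rw [mem_cut]
  rw [iff_comm (a := _ ∈ X)]

theorem Links.mem_inside_iff (h : D.Links e a b) : e ∈ D.inside H Y ↔ e ∈ H ∧ a ∈ Y ∧ b ∈ Y := by
  rcases h with ⟨rfl, rfl⟩ | ⟨rfl, rfl⟩ <;> rw [mem_inside]
  rw [and_comm (a := _ ∈ Y)]

theorem Links.mem_erase (h : D.Links e v w) (hH : D.EdgesIn H V) (hloop : D.Loopless H)
    (he : e ∈ H) : w ∈ V.erase v := by
  have := hH e he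
  have := hloop e he
  grind [Links]

theorem inside_reattach [DecidableEq β] (he : e ∉ H) (Y : Finset α) :
    (D.reattach e a b).inside H Y = D.inside H Y := by
  refine Finset.filter_congr fun f hf => ?_
  have hne := ne_of_mem_of_not_mem hf he
  rw [fst_reattach hne, snd_reattach hne]

theorem cut_reattach [DecidableEq β] (he : e ∉ H) (X : Finset α) :
    (D.reattach e a b).cut H X = D.cut H X := by
  refine Finset.filter_congr fun f hf => ?_
  have hne := ne_of_mem_of_not_mem hf he
  rw [fst_reattach hne, snd_reattach hne]

theorem Sparse.reattach_insert [DecidableEq β] (hH : D.Sparse H) (he : e ∉ H)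
    (hab : ∀ Y, D.Tight H Y → a ∈ Y → b ∉ Y) : (D.reattach e a b).Sparse (insert e H) := by
  intro Y hY
  have hsparse : (D.reattach e a b).Sparse H := fun Z hZ => by
    rw [inside_reattach he]
    exact hH Z hZ
  by_contra! hlt
  obtain ⟨htight, ha, hb⟩ := hsparse.tight_of_not_sparse_insert hY hlt
  rw [fst_reattach_self] at ha
  rw [snd_reattach_self] at hb
  exact hab Y ⟨hY, inside_reattach he Y ▸ htight.2⟩ ha hb

theorem EdgesIn.inside_erase [DecidableEq β] (hH : D.EdgesIn H V) (v : α) :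
    D.inside H (V.erase v) = H \ D.star H v := by
  ext e
  have := hH e
  grind [mem_inside, mem_star]

theorem EdgesIn.sdiff_star [DecidableEq β] (hH : D.EdgesIn H V) (v : α) :
    D.EdgesIn (H \ D.star H v) (V.erase v) := by
  intro e he
  have := hH e
  grind [mem_star]

theorem card_sdiff_star_add_deg [DecidableEq β] (D : Ends α β) (H : Finset β) (v : α) :
    (H \ D.star H v).card + D.deg H v = H.card :=
  Finset.card_sdiff_add_card_eq_card (Finset.filter_subset _ H)

theorem connects_singleton (T : Finset β) (v : α) : D.Connects T {v} := by
  intro X hX hne hXv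
  exact absurd (hne.subset_singleton_iff.1 hX) hXv

theorem connects_of_erase (hf : f ∈ T) (hlinks : D.Links f v w) (hw : w ∈ V.erase v)
    (h : ∀ X ⊆ V, (X.erase v).Nonempty → X.erase v ≠ V.erase v → (D.cut T X).Nonempty) :
    D.Connects T V := by
  intro X hXV hX hXne
  by_cases hne : (X.erase v).Nonempty
  · by_cases heq : X.erase v = V.erase v
    · have hwX : w ∈ X.erase v := heq ▸ hw
      have hvX : v ∉ X := fun hvX => hXne (by
        rw [← Finset.insert_erase hvX, heq, Finset.insert_erase (hXV hvX)])
      exact ⟨f, hlinks.mem_cut_iff.2 ⟨hf, by grind⟩⟩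
    · exact h X hXV hne heq
  · obtain rfl : X = {v} := ((Finset.erase_eq_empty_iff X v).1
      (Finset.not_nonempty_iff_eq_empty.1 hne)).resolve_left hX.ne_empty
    exact ⟨f, hlinks.mem_cut_iff.2 ⟨hf, by grind⟩⟩

theorem Connects.insert_pendant [DecidableEq β] (hT : D.Connects T (V.erase v))
    (hTV : D.EdgesIn T (V.erase v)) (hf : D.Links f v w) (hw : w ∈ V.erase v) :
    D.Connects (insert f T) V := by
  refine connects_of_erase (Finset.mem_insert_self f T) hf hw fun X hXV hX hXne => ?_
  obtain ⟨e, he⟩ := hT (X.erase v) (Finset.erase_subset_erase v hXV) hX hXne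
  refine ⟨e, ?_⟩
  have := hTV e
  grind [mem_cut]

/-- The moved edge `e` from `a` to `b` stands for the path through `v` formed by `e` and `f`, and a
cut that separates `a` from `b` contains an edge of this path. -/
theorem Connects.insert_of_reattach [DecidableEq β]
    (hT : (D.reattach e a b).Connects T (V.erase v))
    (hTV : (D.reattach e a b).EdgesIn T (V.erase v)) (he : D.Links e v a) (hf : D.Links f v b)
    (hb : b ∈ V.erase v) : D.Connects (insert f T) V := by
  refine connects_of_erase (Finset.mem_insert_self f T) hf hb fun X hXV hX hXne => ?_
  obtain ⟨g, hg⟩ := hT (X.erase v) (Finset.erase_subset_erase v hXV) hX hXne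
  by_cases hge : g = e
  · subst hge
    have hgT := (mem_cut.1 hg).1
    rw [(links_reattach g a b).mem_cut_iff] at hg
    by_cases hva : v ∈ X ↔ a ∈ X
    · refine ⟨f, hf.mem_cut_iff.2 ⟨Finset.mem_insert_self f T, ?_⟩⟩
      have ha := (hTV g hgT).1
      rw [fst_reattach_self] at ha
      grind
    · exact ⟨g, he.mem_cut_iff.2 ⟨Finset.mem_insert_of_mem hgT, hva⟩⟩
  · refine ⟨g, ?_⟩
    have := hTV g
    rw [mem_cut, fst_reattach hge, snd_reattach hge] at hg
    rw [fst_reattach hge, snd_reattach hge] at this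
    grind [mem_cut]

theorem doublyConnects_singleton (H : Finset β) (v : α) : D.DoublyConnects H {v} :=
  ⟨∅, H.empty_subset, ∅, H.empty_subset, Finset.disjoint_empty_left ∅, connects_singleton ∅ v,
    connects_singleton ∅ v⟩

theorem DoublyConnects.of_erase_of_deg_eq_two [DecidableEq β] (hH : D.EdgesIn H V)
    (hloop : D.Loopless H) (hdeg : D.deg H v = 2)
    (h : D.DoublyConnects (H \ D.star H v) (V.erase v)) : D.DoublyConnects H V := by
  obtain ⟨e, f, hef, hstar⟩ := Finset.card_eq_two.1 hdeg
  obtain ⟨T₁, hT₁, T₂, hT₂, hdisj, hcon₁, hcon₂⟩ := h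
  have pendant : ∀ g ∈ D.star H v, ∀ T ⊆ H \ D.star H v, D.Connects T (V.erase v) →
      D.Connects (insert g T) V := by
    intro g hg T hT hcon
    obtain ⟨w, hw⟩ := exists_links hg
    exact hcon.insert_pendant ((hH.sdiff_star v).mono hT) hw
      (hw.mem_erase hH hloop (mem_star.1 hg).1)
  refine ⟨insert e T₁, ?_, insert f T₂, ?_, ?_, pendant e ?_ T₁ hT₁ hcon₁,
    pendant f ?_ T₂ hT₂ hcon₂⟩ <;> grind [mem_star, Finset.disjoint_left]

theorem DoublyConnects.of_reattach [DecidableEq β] (hH : D.EdgesIn H V) (hloop : D.Loopless H)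
    (hstar : D.star H v = {e₁, e₂, e₃}) (h₁₃ : e₁ ≠ e₃) (h₂₃ : e₂ ≠ e₃)
    (he₁ : D.Links e₁ v a) (he₂ : D.Links e₂ v b)
    (h : (D.reattach e₁ a b).DoublyConnects (insert e₁ (H \ D.star H v)) (V.erase v)) :
    D.DoublyConnects H V := by
  have he₁H : e₁ ∈ D.star H v := by simp [hstar]
  have he₂H : e₂ ∈ D.star H v := by simp [hstar]
  have ha := he₁.mem_erase hH hloop (mem_star.1 he₁H).1
  have hb := he₂.mem_erase hH hloop (mem_star.1 he₂H).1
  have hH₀V : (D.reattach e₁ a b).EdgesIn (insert e₁ (H \ D.star H v)) (V.erase v) :=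
    (hH.sdiff_star v).reattach_insert ha hb
  have he₃H : e₃ ∈ D.star H v := by simp [hstar]
  obtain ⟨c, he₃⟩ := exists_links he₃H
  have hc := he₃.mem_erase hH hloop (mem_star.1 he₃H).1
  obtain ⟨T₁, hT₁, T₂, hT₂, hdisj, hcon₁, hcon₂, hmem⟩ : ∃ T₁ ⊆ insert e₁ (H \ D.star H v),
      ∃ T₂ ⊆ insert e₁ (H \ D.star H v), Disjoint T₁ T₂ ∧
      (D.reattach e₁ a b).Connects T₁ (V.erase v) ∧
      (D.reattach e₁ a b).Connects T₂ (V.erase v) ∧ e₁ ∉ T₂ := by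
    obtain ⟨T₁, hT₁, T₂, hT₂, hdisj, hcon₁, hcon₂⟩ := h
    by_cases hmem : e₁ ∈ T₂
    · exact ⟨T₂, hT₂, T₁, hT₁, hdisj.symm, hcon₂, hcon₁, Finset.disjoint_right.1 hdisj hmem⟩
    · exact ⟨T₁, hT₁, T₂, hT₂, hdisj, hcon₁, hcon₂, hmem⟩
  have hT₂' : T₂ ⊆ H \ D.star H v := (Finset.subset_insert_iff_of_notMem hmem).1 hT₂
  have hcon₂' : D.Connects T₂ (V.erase v) := fun X hXV hX hne => by
    rw [← cut_reattach hmem]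
    exact hcon₂ X hXV hX hne
  refine ⟨insert e₂ T₁, ?_, insert e₃ T₂, ?_, ?_,
    hcon₁.insert_of_reattach (hH₀V.mono hT₁) he₁ he₂ hb,
    hcon₂'.insert_pendant ((hH.sdiff_star v).mono hT₂') he₃ hc⟩ <;>
  grind [mem_star, Finset.disjoint_left]

theorem Sparse.deg_inside_insert_le_two [DecidableEq β] (hH : D.Sparse H)
    (hY : D.Tight (H \ D.star H v) Y) : D.deg (D.inside H (insert v Y)) v ≤ 2 := by
  have hdisj : Disjoint (D.star (D.inside H (insert v Y)) v) (D.inside (H \ D.star H v) Y) := by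
    grind [mem_star, mem_inside, Finset.disjoint_left]
  have hsub : D.star (D.inside H (insert v Y)) v ∪ D.inside (H \ D.star H v) Y ⊆
      D.inside H (insert v Y) := by
    grind [mem_star, mem_inside]
  have hcard := Finset.card_le_card hsub
  rw [Finset.card_union_of_disjoint hdisj] at hcard
  have hsparse := hH (insert v Y) (Finset.insert_nonempty v Y)
  have := Finset.card_insert_le v Y
  have := hY.2
  rw [deg]
  lia

theorem Sparse.exists_star_eq_of_deg_eq_three [DecidableEq β] (hH : D.Sparse H)
    (hdeg : D.deg H v = 3) : ∃ e₁ e₂ e₃ a b, D.star H v = {e₁, e₂, e₃} ∧ e₁ ≠ e₃ ∧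
      e₂ ≠ e₃ ∧ D.Links e₁ v a ∧ D.Links e₂ v b ∧
      ∀ Y, D.Tight (H \ D.star H v) Y → a ∈ Y → b ∉ Y := by
  obtain ⟨e₁, e₂, e₃, h₁₂, h₁₃, h₂₃, hstar⟩ := Finset.card_eq_three.1 hdeg
  obtain ⟨a, ha⟩ := exists_links (D := D) (e := e₁) (H := H) (v := v) (by simp [hstar])
  obtain ⟨b, hb⟩ := exists_links (D := D) (e := e₂) (H := H) (v := v) (by simp [hstar])
  obtain ⟨c, hc⟩ := exists_links (D := D) (e := e₃) (H := H) (v := v) (by simp [hstar])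
  by_cases hab : ∀ Y, D.Tight (H \ D.star H v) Y → a ∈ Y → b ∉ Y
  · exact ⟨e₁, e₂, e₃, a, b, hstar, h₁₃, h₂₃, ha, hb, hab⟩
  by_cases hbc : ∀ Y, D.Tight (H \ D.star H v) Y → b ∈ Y → c ∉ Y
  · exact ⟨e₂, e₃, e₁, b, c, by grind, h₁₂.symm, h₁₃.symm, hb, hc, hbc⟩
  push Not at hab hbc
  obtain ⟨Y, hY, haY, hbY⟩ := hab
  obtain ⟨Z, hZ, hbZ, hcZ⟩ := hbc
  have htight := hY.union (hH.mono Finset.sdiff_subset) hZ hbY hbZ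
  have hle := hH.deg_inside_insert_le_two htight
  have hsub : D.star H v ⊆ D.star (D.inside H (insert v (Y ∪ Z))) v := by
    intro e he
    obtain ⟨w, hw, hlinks⟩ : ∃ w ∈ Y ∪ Z, D.Links e v w := by grind
    exact mem_star.2 ⟨hlinks.mem_inside_iff.2 ⟨(mem_star.1 he).1, by simp, by simp [hw]⟩,
      (mem_star.1 he).2⟩
  have := Finset.card_le_card hsub
  rw [deg] at hdeg hle
  lia

theorem Sparse.exists_deg_le_three (hH : D.Sparse H) (hHV : D.EdgesIn H V) (hV : V.Nonempty) :
    ∃ v ∈ V, D.deg H v ≤ 3 := by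
  by_contra! hdeg
  have hsum : ∑ v ∈ V, 4 ≤ ∑ v ∈ V, D.deg H v := Finset.sum_le_sum hdeg
  rw [Finset.sum_const, smul_eq_mul, hH.loopless.sum_deg, hHV.cut_eq_empty,
    Finset.card_empty] at hsum
  have := hH V hV
  lia

theorem Tight.two_le_deg (hV : D.Tight H V) (hH : D.Sparse H) (hHV : D.EdgesIn H V)
    (hv : v ∈ V) (hne : (V.erase v).Nonempty) : 2 ≤ D.deg H v := by
  classical
  have hsparse := hH (V.erase v) hne
  rw [hHV.inside_erase] at hsparse
  have hcard := D.card_sdiff_star_add_deg H v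
  have htight := hH.card_inside_eq hV
  rw [hHV.inside_eq] at htight
  have := Finset.card_erase_add_one hv
  lia

end Connects

section DoublyConnects

variable {α β : Type*} [DecidableEq α] {D : Ends α β} {H : Finset β} {V : Finset α}

/-- Remove a vertex of degree two or three, and in the latter case join two of its neighbours by a
new edge that keeps the rest sparse. -/
theorem Sparse.doublyConnects (hH : D.Sparse H) (hHV : D.EdgesIn H V) (hV : D.Tight H V) :
    D.DoublyConnects H V := by
  classical
  induction hn : V.card generalizing D H V with
  | zero => exact absurd (Finset.card_eq_zero.1 hn) hV.1.ne_empty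
  | succ n ih =>
    obtain ⟨v, hv, hdeg⟩ := hH.exists_deg_le_three hHV hV.1
    have hcardV : (V.erase v).card = n := by rw [Finset.card_erase_of_mem hv, hn]; rfl
    obtain hsing | hne := (V.erase v).eq_empty_or_nonempty
    · rw [((Finset.erase_eq_empty_iff V v).1 hsing).resolve_left hV.1.ne_empty]
      exact doublyConnects_singleton H v
    have hdeg' := hV.two_le_deg hH hHV hv hne
    have hcard := D.card_sdiff_star_add_deg H v
    have htight := hH.card_inside_eq hV
    rw [hHV.inside_eq] at htight
    obtain hdeg | hdeg : D.deg H v = 2 ∨ D.deg H v = 3 := by lia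
    · refine .of_erase_of_deg_eq_two hHV hH.loopless hdeg
        (ih (hH.mono Finset.sdiff_subset) (hHV.sdiff_star v) ⟨hne, ?_⟩ hcardV)
      rw [(hHV.sdiff_star v).inside_eq]
      lia
    · obtain ⟨e₁, e₂, e₃, a, b, hstar, h₁₃, h₂₃, ha, hb, hfree⟩ :=
        hH.exists_star_eq_of_deg_eq_three hdeg
      have he₁ : e₁ ∈ D.star H v := by simp [hstar]
      have he₂ : e₂ ∈ D.star H v := by simp [hstar]
      have he₁' : e₁ ∉ H \ D.star H v := by simp [he₁]
      have hEdges : (D.reattach e₁ a b).EdgesIn (insert e₁ (H \ D.star H v)) (V.erase v) :=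
        (hHV.sdiff_star v).reattach_insert (ha.mem_erase hHV hH.loopless (mem_star.1 he₁).1)
          (hb.mem_erase hHV hH.loopless (mem_star.1 he₂).1)
      refine .of_reattach hHV hH.loopless hstar h₁₃ h₂₃ ha hb
        (ih ((hH.mono Finset.sdiff_subset).reattach_insert he₁' hfree) hEdges ⟨hne, ?_⟩ hcardV)
      rw [hEdges.inside_eq, Finset.card_insert_of_notMem he₁']
      lia

end DoublyConnects

section Parity

open scoped symmDiff

variable {α β : Type*} [DecidableEq α] {D : Ends α β} {E H T T₁ T₂ : Finset β}
  {O V : Finset α} {e : β} {a b r x y : α} {k : ℕ} {h : α → ℕ}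

theorem Links.even_deg_singleton (he : D.Links e a b) (hab : a ≠ b) (v : α) :
    Even (D.deg {e} v) ↔ (v = a ↔ v = b) := by
  have hdeg : D.deg {e} v = if v = a ∨ v = b then 1 else 0 := by
    rw [deg, star, Finset.filter_singleton]
    grind [Links]
  grind

theorem even_deg_of_forall_ne (hH : D.EdgesIn H V) (hloop : D.Loopless H) (hr : r ∈ V)
    (heven : ∀ v ∈ V, v ≠ r → Even (D.deg H v)) : Even (D.deg H r) := by
  have hsum := hloop.sum_deg V
  rw [hH.cut_eq_empty, Finset.card_empty, zero_add, ← Finset.add_sum_erase V _ hr] at hsum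
  have hrest : Even (∑ v ∈ V.erase r, D.deg H v) :=
    Finset.even_sum _ fun v hv => heven v (Finset.mem_of_mem_erase hv) (Finset.ne_of_mem_erase hv)
  exact (Nat.even_add.1 (hsum ▸ even_two_mul _)).2 hrest

theorem even_deg_symmDiff [DecidableEq β] (D : Ends α β) (J K : Finset β) (v : α) :
    Even (D.deg (J ∆ K) v) ↔ (Even (D.deg J v) ↔ Even (D.deg K v)) := by
  have hstar : D.star (J ∆ K) v = D.star J v ∆ D.star K v := by
    ext e
    grind [mem_star, Finset.mem_symmDiff]
  have hcard : (D.star J v ∆ D.star K v).card + 2 * (D.star J v ∩ D.star K v).card =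
      (D.star J v).card + (D.star K v).card := by
    have hunion : (D.star J v ∆ D.star K v).card = _ :=
      Finset.card_union_of_disjoint disjoint_sdiff_sdiff
    have := Finset.card_sdiff_add_card_inter (D.star J v) (D.star K v)
    have := Finset.card_inter_add_card_sdiff (D.star K v) (D.star J v)
    rw [Finset.inter_comm] at this
    lia
  rw [← Nat.even_add, deg, deg, deg, ← hcard, hstar, Nat.even_add]
  simp

theorem Connects.exists_join_pair (hT : D.Connects T V) (hTV : D.EdgesIn T V) (hx : x ∈ V)
    (hy : y ∈ V) : ∃ J ⊆ T, ∀ v, Even (D.deg J v) ↔ (v = x ↔ v = y) := by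
  classical
  let C := V.filter fun y => ∃ J ⊆ T, ∀ v, Even (D.deg J v) ↔ (v = x ↔ v = y)
  suffices hCV : C = V from (Finset.mem_filter.1 (hCV ▸ hy : y ∈ C)).2
  by_contra hCV
  have hxC : x ∈ C := Finset.mem_filter.2 ⟨hx, ∅, T.empty_subset, fun v => by simp [deg, star]⟩
  obtain ⟨e, he⟩ := hT C (Finset.filter_subset _ _) ⟨x, hxC⟩ hCV
  have heT := (mem_cut.1 he).1
  obtain ⟨a, b, hab, ha, hb⟩ : ∃ a b, D.Links e a b ∧ a ∈ C ∧ b ∉ C := by grind [mem_cut, Links]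
  have hbV : b ∈ V := by
    have := hTV e heT
    grind [Links]
  obtain ⟨-, J, hJ, hJeven⟩ := Finset.mem_filter.1 ha
  refine hb (Finset.mem_filter.2 ⟨hbV, J ∆ {e}, by grind [Finset.mem_symmDiff], fun v => ?_⟩)
  rw [even_deg_symmDiff, hJeven, hab.even_deg_singleton (ne_of_mem_of_not_mem ha hb)]
  tauto

theorem Connects.exists_join (hT : D.Connects T V) (hTV : D.EdgesIn T V) (hr : r ∈ V)
    (hO : O ⊆ V) : ∃ J ⊆ T, ∀ v ≠ r, Even (D.deg J v) ↔ v ∉ O := by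
  classical
  induction O using Finset.induction_on with
  | empty => exact ⟨∅, T.empty_subset, fun v _ => by simp [deg, star]⟩
  | insert x O hxO ih =>
    obtain ⟨hx, hO⟩ := Finset.insert_subset_iff.1 hO
    obtain ⟨J, hJ, hJeven⟩ := ih hO
    obtain ⟨K, hK, hKeven⟩ := hT.exists_join_pair hTV hx hr
    refine ⟨J ∆ K, by grind [Finset.mem_symmDiff], fun v hv => ?_⟩
    rw [even_deg_symmDiff, hJeven v hv, hKeven]
    grind

theorem Connects.exists_even [DecidableEq β] (h₁ : D.Connects T₁ V)
    (h₂ : D.Connects T₂ V) (hdisj : Disjoint T₁ T₂) (hV : D.EdgesIn (T₁ ∪ T₂) V)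
    (hloop : D.Loopless (T₁ ∪ T₂)) :
    ∃ K ⊆ T₁ ∪ T₂, D.Connects K V ∧ ∀ v ∈ V, Even (D.deg K v) := by
  obtain rfl | ⟨r, hr⟩ := V.eq_empty_or_nonempty
  · exact ⟨T₁, Finset.subset_union_left, h₁, by simp⟩
  obtain ⟨J, hJ, hJeven⟩ := h₂.exists_join (hV.mono Finset.subset_union_right) hr
    (Finset.filter_subset (fun v => Odd (D.deg T₁ v)) V)
  have hK : T₁ ∆ J ⊆ T₁ ∪ T₂ := by grind [Finset.mem_symmDiff]
  have heven : ∀ v ∈ V, v ≠ r → Even (D.deg (T₁ ∆ J) v) := fun v hv hvr => by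
    rw [even_deg_symmDiff, hJeven v hvr, Finset.mem_filter, ← Nat.not_even_iff_odd]
    tauto
  refine ⟨T₁ ∆ J, hK, fun X hXV hX hne => ?_, fun v hv => ?_⟩
  · obtain ⟨e, he⟩ := h₁ X hXV hX hne
    refine ⟨e, ?_⟩
    grind [mem_cut, Finset.mem_symmDiff, Finset.disjoint_left]
  · obtain rfl | hvr := eq_or_ne v r
    · exact even_deg_of_forall_ne (hV.mono hK) (hloop.mono hK) hv heven
    · exact heven v hv hvr

theorem exists_connects_even_deg_le (hk : 4 ≤ k) (hne : V.Nonempty) (hE : D.EdgesIn E V)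
    (hloop : D.Loopless E) (hcut : D.CutsAtLeast k E V)
    (hh : ∀ v ∈ V, 2 * D.deg E v + 4 * k ≤ k * h v + 8) :
    ∃ K ⊆ E, D.Connects K V ∧ ∀ v ∈ V, Even (D.deg K v) ∧ D.deg K v ≤ h v := by
  classical
  obtain ⟨H, hHE, hH, hHV, hdeg⟩ := exists_sparse_tight_deg_le hk hne hE hloop hcut hh
  obtain ⟨T₁, hT₁, T₂, hT₂, hdisj, hcon₁, hcon₂⟩ := hH.doublyConnects (hE.mono hHE) hHV
  have hunion : T₁ ∪ T₂ ⊆ H := Finset.union_subset hT₁ hT₂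
  obtain ⟨K, hK, hcon, heven⟩ := hcon₁.exists_even hcon₂ hdisj (hE.mono (hunion.trans hHE))
    (hloop.mono (hunion.trans hHE))
  have hKH := hK.trans hunion
  exact ⟨K, hKH.trans hHE, hcon, fun v hv => ⟨heven v hv, (deg_mono hKH v).trans (hdeg v hv)⟩⟩

end Parity

end Ends

section Walks

variable {α β : Type*} {G : Graph α β} {x y z : α} {e : β}

theorem mem_vertexSet_of_mem_support (p : G.Walk x y) (hz : z ∈ p.support) : z ∈ V(G) := by
  induction p with
  | nil hx => exact List.mem_singleton.1 hz ▸ hx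
  | cons _ h _ ih => exact (List.mem_cons.1 hz).elim (fun hz => hz ▸ h.left_mem) ih

theorem left_mem_support (p : G.Walk x y) : x ∈ p.support := by
  cases p <;> simp [Graph.Walk.support]

theorem right_mem_support (p : G.Walk x y) : y ∈ p.support := by
  induction p with
  | nil _ => exact List.mem_singleton_self _
  | cons _ _ _ ih => exact List.mem_cons_of_mem _ ih

theorem mem_support_of_inc (p : G.Walk x y) (he : e ∈ p.edges) (hz : G.Inc e z) :
    z ∈ p.support := by
  induction p with
  | nil _ => simp [Graph.Walk.edges] at he
  | cons f h p ih =>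
    obtain rfl | he := List.mem_cons.1 he
    · obtain rfl | rfl := hz.eq_or_eq_of_isLink h
      exacts [List.mem_cons_self, List.mem_cons_of_mem _ (left_mem_support p)]
    · exact List.mem_cons_of_mem _ (ih he)

theorem exists_walk_append (p : G.Walk x y) (q : G.Walk y z) :
    ∃ r : G.Walk x z, r.edges = p.edges ++ q.edges := by
  induction p with
  | nil _ => exact ⟨q, rfl⟩
  | cons e h p ih =>
    obtain ⟨r, hr⟩ := ih q
    exact ⟨.cons e h r, congrArg (e :: ·) hr⟩

theorem exists_walk_split (p : G.Walk x y) (hz : z ∈ p.support) :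
    ∃ (q : G.Walk x z) (r : G.Walk z y), p.edges = q.edges ++ r.edges := by
  induction p with
  | nil hx =>
    obtain rfl := List.mem_singleton.1 hz
    exact ⟨.nil hx, .nil hx, rfl⟩
  | cons e h p ih =>
    obtain rfl | hz := List.mem_cons.1 hz
    · exact ⟨.nil h.left_mem, .cons e h p, rfl⟩
    · obtain ⟨q, r, hqr⟩ := ih hz
      exact ⟨.cons e h q, r, congrArg (e :: ·) hqr⟩

end Walks

namespace Ends

section Presents

variable {α β : Type*}

/-- The finite graph `G` has the vertex set `V` and the edge set `E`, and `D` lists the ends of its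
edges. This carries results on finite edge sets over to `Graph`. -/
structure Presents (D : Ends α β) (E : Finset β) (V : Finset α) (G : Graph α β) : Prop where
  coe_vertexSet : (V : Set α) = V(G)
  coe_edgeSet : (E : Set β) = E(G)
  isLink : ∀ e ∈ E, G.IsLink e (D.fst e) (D.snd e)

theorem exists_presents (G : Graph α β) (hne : V(G).Nonempty) (hV : V(G).Finite)
    (hE : E(G).Finite) :
    ∃ (D : Ends α β) (E : Finset β) (V : Finset α), D.Presents E V G := by
  obtain ⟨x, -⟩ := hne
  have hends : ∀ e, ∃ a b, e ∈ E(G) → G.IsLink e a b := fun e => by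
    by_cases he : e ∈ E(G)
    · obtain ⟨a, b, hab⟩ := Graph.exists_isLink_of_mem_edgeSet he
      exact ⟨a, b, fun _ => hab⟩
    · exact ⟨x, x, fun h => absurd h he⟩
  choose a b hab using hends
  exact ⟨⟨a, b⟩, hE.toFinset, hV.toFinset, hV.coe_toFinset, hE.coe_toFinset, fun e he =>
    hab e (hE.mem_toFinset.1 he)⟩

variable {D : Ends α β} {E K : Finset β} {V : Finset α} {G : Graph α β} {e : β}
  {v x y : α} {k : ℕ}

theorem Presents.mem_vertexSet (hD : D.Presents E V G) : v ∈ V(G) ↔ v ∈ V := by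
  rw [← hD.coe_vertexSet, Finset.mem_coe]

theorem Presents.mem_edgeSet (hD : D.Presents E V G) : e ∈ E(G) ↔ e ∈ E := by
  rw [← hD.coe_edgeSet, Finset.mem_coe]

theorem Presents.edgesIn (hD : D.Presents E V G) : D.EdgesIn E V := fun e he =>
  ⟨hD.mem_vertexSet.1 (hD.isLink e he).left_mem, hD.mem_vertexSet.1 (hD.isLink e he).right_mem⟩

theorem Presents.loopless [G.Loopless] (hD : D.Presents E V G) : D.Loopless E :=
  fun e he => (hD.isLink e he).ne

theorem Presents.isLink_iff (hD : D.Presents E V G) (he : e ∈ E) :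
    G.IsLink e x y ↔ D.Links e x y := by
  constructor
  · exact fun h => (hD.isLink e he).eq_and_eq_or_eq_and_eq h
  · rintro (⟨rfl, rfl⟩ | ⟨rfl, rfl⟩)
    exacts [hD.isLink e he, (hD.isLink e he).symm]

theorem Presents.restrict (hD : D.Presents E V G) (hK : K ⊆ E) :
    D.Presents K V (G.restrict K) where
  coe_vertexSet := hD.coe_vertexSet
  coe_edgeSet := by
    rw [Graph.edgeSet_restrict, ← hD.coe_edgeSet, Set.inter_eq_right.2 (Finset.coe_subset.2 hK)]
  isLink e he := by simpa using ⟨he, hD.isLink e (hK he)⟩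

variable [DecidableEq α]

theorem Presents.degree_eq (hD : D.Presents E V G) (v : α) : G.degree v = D.deg E v := by
  rw [Graph.degree, deg, ← Set.ncard_coe_finset]
  congr 1
  ext e
  simp only [Graph.mem_incidenceSet, Finset.mem_coe, mem_star, Graph.Inc]
  constructor
  · rintro ⟨w, h⟩
    have he := hD.mem_edgeSet.1 h.edge_mem
    have := (hD.isLink_iff he).1 h
    grind [Links]
  · rintro ⟨he, h | h⟩
    exacts [⟨_, h ▸ hD.isLink e he⟩, ⟨_, h ▸ (hD.isLink e he).symm⟩]

theorem Presents.cutsAtLeast (hD : D.Presents E V G) (hG : G.EdgeConnected k) :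
    D.CutsAtLeast k E V := by
  intro X hXV hX hne
  by_contra! hlt
  have hcutE : (D.cut E X : Set β) ⊆ E(G) :=
    hD.coe_edgeSet ▸ Finset.coe_subset.2 (Finset.filter_subset _ _)
  obtain ⟨-, hconn⟩ := hG (D.cut E X) hcutE hlt
  have hstays {x y} (p : (G.deleteEdges (D.cut E X : Set β)).Walk x y) : x ∈ X → y ∈ X := by
    induction p with
    | nil _ => exact id
    | cons e h p ih =>
      intro hx
      rw [Graph.deleteEdges_isLink, Finset.mem_coe] at h
      have he := hD.mem_edgeSet.1 h.1.edge_mem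
      have hcut := ((hD.isLink_iff he).1 h.1).mem_cut_iff (H := E) (X := X)
      exact ih (by tauto)
  obtain ⟨x, hx⟩ := hX
  refine hne (hXV.antisymm fun y hy => ?_)
  obtain ⟨p⟩ := hconn x (hD.mem_vertexSet.2 (hXV hx)) y (hD.mem_vertexSet.2 hy)
  exact hstays p hx

end Presents

end Ends

section Trails

variable {α β : Type*} {G : Graph α β}

/-- The walk `p` is a trail whose edges all lie in `L`. -/
def TrailIn (L : Finset β) {x y : α} (p : G.Walk x y) : Prop := p.IsTrail ∧ ∀ e ∈ p.edges, e ∈ L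

variable {K L : Finset β} {u x y : α}

theorem TrailIn.length_le {p : G.Walk x y} (hp : TrailIn L p) : p.edges.length ≤ L.card := by
  classical
  rw [← List.toFinset_card_of_nodup hp.1]
  exact Finset.card_le_card fun e he => hp.2 e (List.mem_toFinset.1 he)

theorem TrailIn.exists_splice [DecidableEq β] {p : G.Walk x y} {q : G.Walk u u}
    (hp : TrailIn K p) (hq : TrailIn (K \ p.edges.toFinset) q) (hu : u ∈ p.support) :
    ∃ r : G.Walk x y, TrailIn K r ∧ r.edges.length = p.edges.length + q.edges.length := by
  obtain ⟨a, b, hab⟩ := exists_walk_split p hu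
  obtain ⟨c, hc⟩ := exists_walk_append q b
  obtain ⟨r, hr⟩ := exists_walk_append a c
  have hperm : r.edges.Perm (p.edges ++ q.edges) := by
    rw [hr, hc, hab, List.append_assoc]
    exact List.perm_append_comm.append_left _
  have hqK (e) (he : e ∈ q.edges) : e ∈ K ∧ e ∉ p.edges := by simpa using hq.2 e he
  refine ⟨r, ⟨?_, fun e he => ?_⟩, by rw [hperm.length_eq, List.length_append]⟩
  · exact hperm.nodup_iff.2 (hp.1.append hq.1 fun e hep heq => (hqK e heq).2 hep)
  · exact (List.mem_append.1 (hperm.mem_iff.1 he)).elim (hp.2 e) fun he => (hqK e he).1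

end Trails

namespace Ends

section Euler

variable {α β : Type*} [DecidableEq α] {D : Ends α β} {E H K L : Finset β} {V : Finset α}
  {G : Graph α β} {e : β} {a b u x y z : α} {n : ℕ}

theorem Links.deg_insert [DecidableEq β] (h : D.Links e a b) (he : e ∉ H) (v : α) :
    D.deg (insert e H) v = D.deg H v + if v = a ∨ v = b then 1 else 0 := by
  have hiff : D.fst e = v ∨ D.snd e = v ↔ v = a ∨ v = b := by grind [Links]
  simp only [deg, star, Finset.filter_insert, hiff]
  split_ifs
  · exact Finset.card_insert_of_notMem fun h => he (Finset.mem_filter.1 h).1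
  · rfl

theorem deg_sdiff_add [DecidableEq β] (hL : L ⊆ K) (v : α) :
    D.deg (K \ L) v + D.deg L v = D.deg K v := by
  have hstar : D.star (K \ L) v = D.star K v \ D.star L v := by grind [mem_star]
  rw [deg, deg, deg, hstar]
  exact Finset.card_sdiff_add_card_eq_card (Finset.filter_subset_filter _ hL)

theorem Presents.exists_mem_star_of_not_isSpanning [DecidableEq β] (hD : D.Presents E V G)
    (hK : K ⊆ E) (hconn : D.Connects K V) {p : G.Walk x y} (hp : ¬p.IsSpanning) :
    ∃ u ∈ p.support, ∃ e, e ∈ D.star (K \ p.edges.toFinset) u := by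
  simp only [Graph.Walk.IsSpanning, not_forall, hD.mem_vertexSet] at hp
  obtain ⟨w, hwV, hwp⟩ := hp
  have hsub : p.support.toFinset ⊆ V := fun v hv =>
    hD.mem_vertexSet.1 (mem_vertexSet_of_mem_support p (List.mem_toFinset.1 hv))
  have hne : p.support.toFinset ≠ V := fun h => hwp (List.mem_toFinset.1 (h ▸ hwV))
  obtain ⟨e, he⟩ := hconn _ hsub ⟨x, List.mem_toFinset.2 (left_mem_support p)⟩ hne
  simp only [mem_cut, List.mem_toFinset] at he
  have hlink := hD.isLink e (hK he.1)
  have hep : e ∉ p.edges := fun h => he.2 (iff_of_true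
    (mem_support_of_inc p h hlink.inc_left) (mem_support_of_inc p h hlink.inc_right))
  have heK : e ∈ K \ p.edges.toFinset := by simpa using ⟨he.1, hep⟩
  by_cases h : D.fst e ∈ p.support
  · exact ⟨_, h, e, mem_star.2 ⟨heK, .inl rfl⟩⟩
  · exact ⟨D.snd e, by tauto, e, mem_star.2 ⟨heK, .inr rfl⟩⟩

variable [G.Loopless]

theorem Presents.deg_edges_add [DecidableEq β] (hD : D.Presents E V G) {p : G.Walk x y}
    (hp : p.IsTrail) (z : α) :
    D.deg p.edges.toFinset z + (if z = x then 1 else 0) + (if z = y then 1 else 0) =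
      2 * p.support.count z := by
  induction p with
  | nil _ =>
    have hempty : D.deg ∅ z = 0 := rfl
    simp only [Graph.Walk.edges, Graph.Walk.support, List.toFinset_nil,
      List.count_singleton, beq_iff_eq]
    grind
  | @cons x w y e h p ih =>
    have hlinks := (hD.isLink_iff (hD.mem_edgeSet.1 h.edge_mem)).1 h
    obtain ⟨he, hp⟩ := List.nodup_cons.1 hp
    have := ih hp
    have := h.ne
    rw [Graph.Walk.edges, List.toFinset_cons, hlinks.deg_insert (by simpa using he),
      Graph.Walk.support, List.count_cons]
    grind

theorem Presents.even_deg_edges [DecidableEq β] (hD : D.Presents E V G) {p : G.Walk x x}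
    (hp : p.IsTrail) (z : α) : Even (D.deg p.edges.toFinset z) := by
  have := hD.deg_edges_add hp z
  grind

theorem Presents.exists_trail_succ (hD : D.Presents E V G) (hL : L ⊆ E) {p : G.Walk x y}
    (hp : TrailIn L p) (hxy : y ≠ x) (heven : Even (D.deg L y)) :
    ∃ (z : α) (q : G.Walk x z), TrailIn L q ∧ q.edges.length = p.edges.length + 1 := by
  classical
  have hodd : ¬Even (D.deg p.edges.toFinset y) := by
    have := hD.deg_edges_add hp.1 y
    grind
  have hsub : p.edges.toFinset ⊆ L := fun e he => hp.2 e (List.mem_toFinset.1 he)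
  have hlt : D.deg p.edges.toFinset y < D.deg L y :=
    (deg_mono hsub y).lt_of_ne fun h => hodd (h ▸ heven)
  obtain ⟨e, he, hep⟩ := Finset.exists_mem_notMem_of_card_lt_card hlt
  obtain ⟨heL, hey⟩ := mem_star.1 he
  obtain ⟨z, hz⟩ := exists_links he
  have hlink := (hD.isLink_iff (hL heL)).2 hz
  obtain ⟨q, hq⟩ := exists_walk_append p (.cons e hlink (.nil hlink.right_mem))
  have hnew : e ∉ p.edges := fun h => hep (mem_star.2 ⟨List.mem_toFinset.2 h, hey⟩)
  have hperm : q.edges.Perm (e :: p.edges) := hq ▸ List.perm_append_singleton e p.edges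
  refine ⟨z, q, ⟨hperm.nodup_iff.2 (List.nodup_cons.2 ⟨hnew, hp.1⟩), fun f hf => ?_⟩,
    hperm.length_eq⟩
  exact (List.mem_cons.1 (hperm.mem_iff.1 hf)).elim (fun h => h ▸ heL) (hp.2 f)

theorem Presents.exists_closed_trail (hD : D.Presents E V G) (hL : L ⊆ E)
    (heven : ∀ v ∈ V, Even (D.deg L v)) (he : e ∈ D.star L u) :
    ∃ q : G.Walk u u, TrailIn L q ∧ q.edges ≠ [] := by
  have heL := (mem_star.1 he).1
  obtain ⟨w, hw⟩ := exists_links he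
  have hlink := (hD.isLink_iff (hL heL)).2 hw
  by_contra! hno
  have hlong (n : ℕ) : ∃ (y : α) (p : G.Walk u y), TrailIn L p ∧ p.edges.length = n + 1 := by
    induction n with
    | zero =>
      exact ⟨w, .cons e hlink (.nil hlink.right_mem), ⟨List.nodup_singleton e, by
        simpa [Graph.Walk.edges] using heL⟩, rfl⟩
    | succ n ih =>
      obtain ⟨y, p, hp, hlen⟩ := ih
      have hyu : y ≠ u := by
        rintro rfl
        simp [hno p hp] at hlen
      have hyV : y ∈ V := hD.mem_vertexSet.1 (mem_vertexSet_of_mem_support p (right_mem_support p))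
      rw [← hlen]
      exact hD.exists_trail_succ hL hp hyu (heven y hyV)
  obtain ⟨y, p, hp, hlen⟩ := hlong L.card
  have := hp.length_le
  lia

theorem Presents.exists_spanning_closed_trail (hD : D.Presents E V G) (hK : K ⊆ E)
    (hconn : D.Connects K V) (heven : ∀ v ∈ V, Even (D.deg K v)) (hx : x ∈ V(G)) :
    ∃ p : G.Walk x x, TrailIn K p ∧ p.IsSpanning := by
  classical
  by_contra! hno
  have hlong (n : ℕ) : ∃ p : G.Walk x x, TrailIn K p ∧ n ≤ p.edges.length := by
    induction n with
    | zero => exact ⟨.nil hx, ⟨List.nodup_nil, by simp [Graph.Walk.edges]⟩, Nat.zero_le _⟩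
    | succ n ih =>
      obtain ⟨p, hp, hlen⟩ := ih
      obtain ⟨u, hu, e, he⟩ := hD.exists_mem_star_of_not_isSpanning hK hconn (hno p hp)
      have hpK : p.edges.toFinset ⊆ K := fun e he => hp.2 e (List.mem_toFinset.1 he)
      have hrest (v) (hv : v ∈ V) : Even (D.deg (K \ p.edges.toFinset) v) := by
        have hK := heven v hv
        rw [← deg_sdiff_add hpK v, Nat.even_add] at hK
        exact hK.2 (hD.even_deg_edges hp.1 v)
      obtain ⟨q, hq, hqne⟩ := hD.exists_closed_trail (Finset.sdiff_subset.trans hK) hrest he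
      obtain ⟨r, hr, hrlen⟩ := hp.exists_splice hq hu
      have := List.length_pos_iff.2 hqne
      exact ⟨r, hr, by lia⟩
  obtain ⟨p, hp, hlen⟩ := hlong (K.card + 1)
  have := hp.length_le
  lia

theorem Presents.visits_le (hD : D.Presents E V G) {p : G.Walk x x} (hp : TrailIn K p)
    (hn : 1 ≤ n) (hz : D.deg K z ≤ 2 * n + 1) : p.visits z ≤ n := by
  classical
  have hpK : p.edges.toFinset ⊆ K := fun e he => hp.2 e (List.mem_toFinset.1 he)
  have hdeg := hD.deg_edges_add hp.1 z
  have := deg_mono (D := D) hpK z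
  have hsupp : p.support = x :: p.support.tail := by cases p <;> rfl
  have hvisits : p.visits z =
      if p.edges = [] then p.support.count z else p.support.tail.count z := by
    rw [Graph.Walk.visits]
    congr!
  rw [hvisits]
  split_ifs with hp
  · cases p with
    | nil _ => exact List.count_le_length.trans hn
    | cons => cases hp
  · rw [hsupp, List.count_cons] at hdeg
    grind

end Euler

end Ends

section Matching

variable {W : Type*} {G : SimpleGraph W} {m : W → W}

theorem even_card_of_involutive (hm : Function.Involutive m) (hne : ∀ a, m a ≠ a) {s : Finset W}
    (hs : ∀ a ∈ s, m a ∈ s) : Even s.card := by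
  rw [← ZMod.natCast_eq_zero_iff_even, Finset.card_eq_sum_ones, Nat.cast_sum]
  exact Finset.sum_involution (fun a _ => m a) (fun _ _ => by decide) (fun a _ _ => hne a) hs
    fun a _ => hm a

theorem exists_involutive_of_isPerfectMatching {M : G.Subgraph} (hM : M.IsPerfectMatching) :
    ∃ m : W → W, Function.Involutive m ∧ ∀ a, G.Adj a (m a) := by
  choose m hm using fun a => (hM.1 (hM.2 a)).exists
  exact ⟨m, fun a => hM.1.eq_of_adj_left (hm (m a)) (hm a).symm, fun a => M.adj_sub (hm a)⟩

theorem exists_componentLabel (G : SimpleGraph W) (U : Set W) :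
    ∃ κ : W → Option ((⊤ : G.Subgraph).deleteVerts U).coe.ConnectedComponent,
      (∀ γ, ∃ w, κ w = some γ) ∧
      (∀ a b γ γ', G.Adj a b → κ a = some γ → κ b = some γ' → γ = γ') ∧
      {w | κ w = none} = U := by
  classical
  set H := ((⊤ : G.Subgraph).deleteVerts U).coe with hH
  have hverts (w) : w ∈ ((⊤ : G.Subgraph).deleteVerts U).verts ↔ w ∉ U := by simp
  refine ⟨fun w => if h : w ∈ U then none else some (H.connectedComponentMk ⟨w, (hverts w).2 h⟩),
    fun γ => ?_, fun a b γ γ' hab ha hb => ?_, by ext w; simp⟩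
  · induction γ using SimpleGraph.ConnectedComponent.ind with
    | _ w => exact ⟨w.1, dif_neg ((hverts w.1).1 w.2)⟩
  · obtain ⟨haU, ha⟩ := Option.dite_none_left_eq_some.1 ha
    obtain ⟨hbU, hb⟩ := Option.dite_none_left_eq_some.1 hb
    rw [← Option.some_inj, ← ha, ← hb, Option.some_inj]
    refine SimpleGraph.ConnectedComponent.sound (SimpleGraph.Adj.reachable ?_)
    simp [hH, haU, hbU, hab]

/-- Labels constant on adjacent vertices bound the number of components left by the unlabelled
vertices, so this is Tutte's condition. A single odd component is excluded by parity. -/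
theorem exists_isPerfectMatching_of_card_le {W : Type u} [Fintype W] {G : SimpleGraph W}
    (heven : Even (Fintype.card W))
    (hcard : ∀ (Γ : Type u) [Fintype Γ] (κ : W → Option Γ), (∀ γ, ∃ w, κ w = some γ) →
      (∀ a b γ γ', G.Adj a b → κ a = some γ → κ b = some γ' → γ = γ') →
      Fintype.card Γ ≤ max 1 (Set.ncard {w | κ w = none})) :
    ∃ M : G.Subgraph, M.IsPerfectMatching := by
  rw [SimpleGraph.tutte]
  intro U hU
  rw [SimpleGraph.IsTutteViolator] at hU
  set H := ((⊤ : G.Subgraph).deleteVerts U).coe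
  let _ := Fintype.ofFinite H.ConnectedComponent
  have hodd : H.oddComponents.ncard ≤ Fintype.card H.ConnectedComponent := by
    rw [← Nat.card_eq_fintype_card, ← Set.ncard_univ]
    exact Set.ncard_le_ncard (Set.subset_univ _)
  obtain ⟨κ, hsurj, hadj, hnone⟩ := exists_componentLabel G U
  have hle := hcard _ κ hsurj hadj
  rw [hnone] at hle
  obtain rfl : U = ∅ := (Set.ncard_eq_zero).1 (by lia)
  have hone : H.oddComponents.ncard = 1 := by simp at hU hle; lia
  have hodd := H.odd_ncard_oddComponents.1 (hone ▸ odd_one)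
  rw [Nat.card_congr (Equiv.subtypeUnivEquiv fun w => by simp), Nat.card_eq_fintype_card] at hodd
  exact Nat.not_odd_iff_even.2 heven hodd

end Matching

namespace Ends

section Gadget

variable {α β : Type*} (D : Ends α β)

/-- The vertex at which the half-edge `h` is attached: a half-edge is an edge together with a choice
of one of its two ends. -/
def endAt (h : β × Bool) : α := if h.2 then D.snd h.1 else D.fst h.1

/-- The vertices of `gadget`: all half-edges, and `c v` slots at every vertex `v`. -/
abbrev GadgetVertex (_D : Ends α β) (c : α → ℕ) : Type _ := (β × Bool) ⊕ (Σ v : α, Fin (c v))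

/-- The vertex at which a half-edge or a slot is placed. -/
def place {c : α → ℕ} : D.GadgetVertex c → α := Sum.elim D.endAt Sigma.fst

/-- The graph in which a half-edge is adjacent to the other half of its edge and to all half-edges
and slots at its vertex, while slots are not adjacent to each other. In a perfect matching, the
edges whose halves are matched with each other form an edge set `J` such that removing `J` and `c v`
more half-edges at every `v` leaves even degrees. -/
def gadget (c : α → ℕ) : SimpleGraph (D.GadgetVertex c) :=
  .fromRel fun a b => ∃ h, a = .inl h ∧ (D.place b = D.endAt h ∨ b = .inl (h.1, !h.2))

variable {D} {c : α → ℕ} {m : D.GadgetVertex c → D.GadgetVertex c} {a : D.GadgetVertex c}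
  {h h' : β × Bool} {L : Finset β} {v : α}

theorem gadget_adj_of_endAt_eq (hne : h ≠ h') (hend : D.endAt h = D.endAt h') :
    (D.gadget c).Adj (.inl h) (.inl h') :=
  ⟨Sum.inl_injective.ne hne, .inl ⟨h, rfl, .inl hend.symm⟩⟩

theorem gadget_adj_slot {s : Σ v : α, Fin (c v)} (hend : D.endAt h = s.1) :
    (D.gadget c).Adj (.inl h) (.inr s) :=
  ⟨Sum.inl_ne_inr, .inl ⟨h, rfl, .inl hend.symm⟩⟩

theorem gadget_adj_halves (e : β) : (D.gadget c).Adj (.inl (e, false)) (.inl (e, true)) :=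
  ⟨by simp, .inl ⟨_, rfl, .inr rfl⟩⟩

theorem gadget_adj_cases {b : D.GadgetVertex c} (hab : (D.gadget c).Adj a b) :
    D.place a = D.place b ∧ (a.isLeft ∨ b.isLeft) ∨
      ∃ e i, a = .inl (e, i) ∧ b = .inl (e, !i) := by
  obtain ⟨-, ⟨h, rfl, hb⟩ | ⟨h, rfl, ha⟩⟩ := hab
  · exact hb.imp (fun hb => ⟨hb.symm, .inl rfl⟩) fun hb => ⟨h.1, h.2, rfl, hb⟩
  · exact ha.imp (fun ha => ⟨ha, .inr rfl⟩) fun ha => ⟨h.1, !h.2, ha, by simp⟩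

variable (D c) [DecidableEq α]

/-- The half-edges at `v` of the edges of `L`, and the slots at `v`. -/
def placedAt (L : Finset β) (v : α) : Finset (D.GadgetVertex c) :=
  ((L ×ˢ Finset.univ).filter fun h => D.endAt h = v).disjSum
    (Finset.univ.map (Function.Embedding.sigmaMk v))

variable {D c}

theorem inl_mem_placedAt : .inl h ∈ D.placedAt c L v ↔ h.1 ∈ L ∧ D.endAt h = v := by
  simp [placedAt]

theorem mem_placedAt_iff : a ∈ D.placedAt c L v ↔
    D.place a = v ∧ ∀ e i, a = .inl (e, i) → e ∈ L := by
  rcases a with ⟨e, i⟩ | ⟨w, i⟩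
  · simp [inl_mem_placedAt, place, and_comm]
  · simp only [placedAt, Finset.inr_mem_disjSum, Finset.mem_map, Finset.mem_univ, true_and,
      Function.Embedding.sigmaMk_apply, place, Sum.elim_inr]
    refine ⟨?_, ?_⟩
    · rintro ⟨i, hi⟩
      cases hi
      exact ⟨rfl, by simp⟩
    · rintro ⟨rfl, -⟩
      exact ⟨i, rfl⟩

theorem card_halves (hloop : D.Loopless L) (v : α) :
    ((L ×ˢ Finset.univ).filter fun h => D.endAt h = v).card = D.deg L v := by
  refine Finset.card_nbij Prod.fst (fun h hh => ?_) (fun h hh h' hh' heq => ?_) fun e he => ?_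
  · grind [mem_star, endAt]
  · have := hloop h.1
    simp only [Finset.coe_filter, Finset.mem_product, Set.mem_ofPred_eq] at hh hh'
    grind [endAt]
  · obtain ⟨heL, h | h⟩ := mem_star.1 he
    exacts [⟨(e, false), Finset.mem_coe.2 (by grind [endAt]), rfl⟩,
      ⟨(e, true), Finset.mem_coe.2 (by grind [endAt]), rfl⟩]

theorem card_placedAt (hloop : D.Loopless L) (v : α) :
    (D.placedAt c L v).card = D.deg L v + c v := by
  rw [placedAt, Finset.card_disjSum, card_halves hloop, Finset.card_map, Finset.card_univ,
    Fintype.card_fin]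

theorem mem_placedAt_of_involutive [Fintype β] [DecidableEq β] {J : Finset β}
    (hm : Function.Involutive m) (hadj : ∀ a, (D.gadget c).Adj a (m a))
    (hJ : ∀ e i, m (.inl (e, i)) = .inl (e, !i) ↔ e ∈ J) (ha : a ∈ D.placedAt c Jᶜ v) :
    m a ∈ D.placedAt c Jᶜ v ∧ (a.isLeft ∨ (m a).isLeft) := by
  obtain ⟨hplace, haJ⟩ := mem_placedAt_iff.1 ha
  obtain ⟨heq, hleft⟩ | ⟨e, i, rfl, hma⟩ := gadget_adj_cases (hadj a)
  · refine ⟨mem_placedAt_iff.2 ⟨heq ▸ hplace, fun e i hma => ?_⟩, hleft⟩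
    rw [Finset.mem_compl, ← hJ e i, ← hma, hm]
    rintro rfl
    exact Finset.mem_compl.1 (haJ e (!i) rfl) ((hJ e (!i)).1 (by simpa using hma))
  · exact absurd ((hJ e i).1 hma) (Finset.mem_compl.1 (haJ e i rfl))

theorem exists_even_deg_add_of_involutive [Fintype β] (hloop : D.Loopless Finset.univ)
    (hm : Function.Involutive m) (hadj : ∀ a, (D.gadget c).Adj a (m a)) :
    ∃ J : Finset β, ∀ v, Even (D.deg Finset.univ v + D.deg J v + c v) ∧
      D.deg J v + c v ≤ D.deg Finset.univ v := by
  classical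
  let J : Finset β := {e | m (.inl (e, false)) = .inl (e, true)}
  have hmJ (e) (i) : m (.inl (e, i)) = .inl (e, !i) ↔ e ∈ J := by
    cases i
    · simp [J]
    · rw [hm.eq_iff, eq_comm]
      simp [J]
  have hmaps (v) (a) (ha : a ∈ D.placedAt c Jᶜ v) := mem_placedAt_of_involutive hm hadj hmJ ha
  refine ⟨J, fun v => ?_⟩
  have hdeg : D.deg Jᶜ v + D.deg J v = D.deg Finset.univ v := deg_sdiff_add J.subset_univ v
  have hcard := card_placedAt (c := c) (hloop.mono Jᶜ.subset_univ) v
  have heven := even_card_of_involutive hm (fun a => (hadj a).ne') fun a ha => (hmaps v a ha).1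
  have hslots : c v ≤ D.deg Jᶜ v := by
    rw [← card_halves (hloop.mono Jᶜ.subset_univ), ← Fintype.card_fin (c v), ← Finset.card_univ,
      ← Finset.card_map (Function.Embedding.inl : _ ↪ D.GadgetVertex c)]
    refine Finset.card_le_card_of_injOn (fun i => m (.inr ⟨v, i⟩)) (fun i _ => ?_)
      fun i _ j _ h => ?_
    · obtain ⟨hmem, hleft⟩ := hmaps v (.inr ⟨v, i⟩) (mem_placedAt_iff.2 ⟨rfl, by simp⟩)
      obtain ⟨h, hh⟩ := Sum.isLeft_iff.1 (hleft.resolve_left (by simp))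
      rw [hh, inl_mem_placedAt] at hmem
      simpa [hh] using hmem
    · simpa using hm.injective h
  rw [hcard] at heven
  exact ⟨by grind, by lia⟩

end Gadget

section Labels

variable {α β Γ : Type*} {D : Ends α β} {c : α → ℕ} {κ : D.GadgetVertex c → Option Γ}

theorem exists_vertexLabel
    (hκ : ∀ a b γ γ', (D.gadget c).Adj a b → κ a = some γ → κ b = some γ' → γ = γ') :
    ∃ l : α → Option Γ, (∀ h, κ (.inl h) = none ∨ κ (.inl h) = l (D.endAt h)) ∧
      ∀ v γ, l v = some γ → ∃ h, D.endAt h = v ∧ κ (.inl h) = some γ := by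
  have hlabel (v : α) : ∃ o : Option Γ,
      (∀ h, D.endAt h = v → κ (.inl h) = none ∨ κ (.inl h) = o) ∧
      ∀ γ, o = some γ → ∃ h, D.endAt h = v ∧ κ (.inl h) = some γ := by
    by_cases hv : ∃ h γ, D.endAt h = v ∧ κ (.inl h) = some γ
    · obtain ⟨h, γ, rfl, hγ⟩ := hv
      refine ⟨some γ, fun h' hend => ?_, fun γ' hγ' => ⟨h, rfl, hγ.trans hγ'⟩⟩
      rcases hh' : κ (.inl h') with _ | γ'
      · exact .inl rfl
      · rcases eq_or_ne h h' with rfl | hne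
        · exact .inr (hh'.symm.trans hγ)
        · rw [hκ _ _ _ _ (gadget_adj_of_endAt_eq hne hend.symm) hγ hh']
          exact .inr rfl
    · push Not at hv
      refine ⟨none, fun h hend => .inl ?_, by simp⟩
      exact Option.eq_none_iff_forall_ne_some.2 fun γ => hv h γ hend
  choose l hl hl' using hlabel
  exact ⟨l, fun h => hl _ h rfl, hl'⟩

variable [Fintype Γ]

theorem card_separating_labels_add_le [DecidableEq Γ] {o₁ o₂ p₁ p₂ : Option Γ}
    (h₁ : p₁ = none ∨ p₁ = o₁) (h₂ : p₂ = none ∨ p₂ = o₂)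
    (h : ∀ γ γ', p₁ = some γ → p₂ = some γ' → γ = γ') :
    (Finset.univ.filter fun γ => ¬(o₁ = some γ ↔ o₂ = some γ)).card +
      2 * ((if o₁ = none then 1 else 0) + if o₂ = none then 1 else 0) ≤
    3 * ((if p₁ = none then 1 else 0) + if p₂ = none then 1 else 0) := by
  have hsubset : (Finset.univ.filter fun γ => ¬(o₁ = some γ ↔ o₂ = some γ)) ⊆
      o₁.toFinset ∪ o₂.toFinset := by grind [Option.mem_toFinset]
  have hcard := (Finset.card_le_card hsubset).trans (Finset.card_union_le _ _)
  rcases o₁ with _ | a <;> rcases o₂ with _ | b <;> rcases h₁ with rfl | rfl <;>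
    rcases h₂ with rfl | rfl <;> simp_all <;> lia

theorem sum_card_cut_add_le [Fintype α] [Fintype β] [DecidableEq α] [DecidableEq Γ]
    {l : α → Option Γ} (hloop : D.Loopless Finset.univ)
    (hκ : ∀ e γ γ', κ (.inl (e, false)) = some γ → κ (.inl (e, true)) = some γ' → γ = γ')
    (hl : ∀ h, κ (.inl h) = none ∨ κ (.inl h) = l (D.endAt h)) :
    ∑ γ, (D.cut Finset.univ {v | l v = some γ}).card +
        2 * ∑ v with l v = none, D.deg Finset.univ v ≤
      3 * (Finset.univ.filter fun h => κ (.inl h) = none).card := by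
  have hcuts : ∑ γ, (D.cut Finset.univ {v | l v = some γ}).card = ∑ e,
      (Finset.univ.filter fun γ => ¬(l (D.fst e) = some γ ↔ l (D.snd e) = some γ)).card := by
    simpa only [cut, Finset.mem_filter, Finset.mem_univ, true_and, Finset.bipartiteAbove,
      Finset.bipartiteBelow] using Finset.sum_card_bipartiteAbove_eq_sum_card_bipartiteBelow
        (s := Finset.univ) (t := Finset.univ)
        fun γ e => ¬(l (D.fst e) = some γ ↔ l (D.snd e) = some γ)
  have hdeg : ∑ v with l v = none, D.deg Finset.univ v =
      (Finset.univ.filter fun h => l (D.endAt h) = none).card := by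
    rw [Finset.card_eq_sum_card_fiberwise (f := D.endAt) (t := {v | l v = none})
      fun h hh => by simpa using hh]
    refine Finset.sum_congr rfl fun v hv => ?_
    rw [← card_halves hloop]
    congr 1
    grind
  rw [hcuts, hdeg, Finset.card_filter, Finset.card_filter, Fintype.sum_prod_type,
    Fintype.sum_prod_type, Finset.mul_sum, Finset.mul_sum, ← Finset.sum_add_distrib]
  refine Finset.sum_le_sum fun e _ => ?_
  rw [Fintype.sum_bool, Fintype.sum_bool, add_comm (ite _ _ _), add_comm (ite (κ _ = _) _ _)]
  exact card_separating_labels_add_le (hl (e, false)) (hl (e, true)) (hκ e)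

theorem card_unused_labels_le [Fintype α] [DecidableEq Γ] {l : α → Option Γ}
    (hκ : ∀ a b γ γ', (D.gadget c).Adj a b → κ a = some γ → κ b = some γ' → γ = γ')
    (hl : ∀ h, κ (.inl h) = none ∨ κ (.inl h) = l (D.endAt h))
    (hl' : ∀ v γ, l v = some γ → ∃ h, D.endAt h = v ∧ κ (.inl h) = some γ)
    (hsurj : ∀ γ, ∃ a, κ a = some γ) :
    (Finset.univ.filter fun γ => ∀ v, l v ≠ some γ).card ≤ ∑ v with l v = none, c v := by
  have hslot (γ) (hγ : ∀ v, l v ≠ some γ) : ∃ s : Σ v, Fin (c v), l s.1 = none ∧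
      κ (.inr s) = some γ := by
    obtain ⟨h | s, ha⟩ := hsurj γ
    · exact absurd ((hl h).resolve_left (by simp [ha]) |>.symm.trans ha) (hγ _)
    · refine ⟨s, Option.eq_none_iff_forall_ne_some.2 fun γ' hγ' => ?_, ha⟩
      obtain ⟨h, hend, hh⟩ := hl' _ _ hγ'
      exact hγ _ (hκ _ _ _ _ (gadget_adj_slot hend) hh ha ▸ hγ')
  rw [← Finset.card_map .some]
  calc ((Finset.univ.filter fun γ => ∀ v, l v ≠ some γ).map .some).card
      ≤ (((Finset.univ.filter fun v => l v = none).sigma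
          fun v => (Finset.univ : Finset (Fin (c v)))).image fun s => κ (.inr s)).card := by
        refine Finset.card_le_card fun o ho => ?_
        obtain ⟨γ, hγ, rfl⟩ := Finset.mem_map.1 ho
        obtain ⟨s, hs, hs'⟩ := hslot γ (by simpa using hγ)
        exact Finset.mem_image.2 ⟨s, by simpa using hs, hs'⟩
    _ ≤ ∑ v with l v = none, c v := Finset.card_image_le.trans (by simp)

theorem three_mul_card_used_labels_le [Fintype α] [Fintype β] [DecidableEq α] [DecidableEq Γ]
    {l : α → Option Γ} (hcut : D.CutsAtLeast 3 Finset.univ Finset.univ)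
    (hconst : ∀ γ, ∃ v, l v ≠ some γ) :
    3 * (Finset.univ.filter fun γ => ∃ v, l v = some γ).card ≤
      ∑ γ, (D.cut Finset.univ {v | l v = some γ}).card := by
  rw [mul_comm, ← smul_eq_mul]
  refine (Finset.card_nsmul_le_sum _ _ _ fun γ hγ => ?_).trans
    (Finset.sum_le_univ_sum_of_nonneg fun _ => zero_le)
  obtain ⟨v, hv⟩ := (Finset.mem_filter.1 hγ).2
  obtain ⟨w, hw⟩ := hconst γ
  refine hcut _ (Finset.subset_univ _) ⟨v, by simpa using hv⟩ fun heq => hw ?_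
  simpa using heq.ge (Finset.mem_univ w)

theorem card_labels_le [Fintype α] [Fintype β] [DecidableEq α]
    (hloop : D.Loopless Finset.univ) (hcut : D.CutsAtLeast 3 Finset.univ Finset.univ)
    (hc : ∀ v, 3 * c v ≤ 2 * D.deg Finset.univ v)
    (hκ : ∀ a b γ γ', (D.gadget c).Adj a b → κ a = some γ → κ b = some γ' → γ = γ')
    (hsurj : ∀ γ, ∃ a, κ a = some γ) :
    Fintype.card Γ ≤ max 1 (Set.ncard {a | κ a = none}) := by
  classical
  obtain ⟨l, hl, hl'⟩ := exists_vertexLabel hκ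
  have hunused := card_unused_labels_le hκ hl hl' hsurj
  by_cases hconst : ∃ γ, ∀ v, l v = some γ
  · obtain ⟨γ, hγ⟩ := hconst
    have hzero : ∑ v with l v = none, c v = 0 := by simp [hγ]
    refine le_max_of_le_left (Fintype.card_le_one_iff.2 fun γ₁ γ₂ => ?_)
    rw [hzero, Nat.le_zero, Finset.card_eq_zero, Finset.filter_eq_empty_iff] at hunused
    have h₁ := hunused (Finset.mem_univ γ₁)
    have h₂ := hunused (Finset.mem_univ γ₂)
    grind
  · push Not at hconst
    have hused := three_mul_card_used_labels_le hcut hconst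
    have hslots : 3 * ∑ v with l v = none, c v ≤ 2 * ∑ v with l v = none, D.deg Finset.univ v := by
      rw [Finset.mul_sum, Finset.mul_sum]
      exact Finset.sum_le_sum fun v _ => hc v
    have hhalves : (Finset.univ.filter fun h => κ (.inl h) = none).card ≤
        Set.ncard {a | κ a = none} := by
      rw [← Finset.card_map (Function.Embedding.inl : _ ↪ D.GadgetVertex c), ← Set.ncard_coe_finset]
      refine Set.ncard_le_ncard (fun a ha => ?_) (Set.toFinite _)
      obtain ⟨h, hh, rfl⟩ := Finset.mem_map.1 ha
      exact (Finset.mem_filter.1 hh).2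
    have hcard := Finset.card_filter_add_card_filter_not (s := Finset.univ)
      fun γ => ∃ v, l v = some γ
    simp only [not_exists, Finset.card_univ] at hcard
    have hsum := sum_card_cut_add_le hloop
      (fun e γ γ' => hκ _ _ γ γ' (gadget_adj_halves e)) hl
    exact le_max_of_le_right (by lia)
end Labels

section OddJoin

variable {α β : Type*} {D : Ends α β} [DecidableEq α]

theorem card_cut_map {α' β' : Type*} [DecidableEq α'] {D' : Ends α' β'} {f : α' ↪ α} {g : β' ↪ β}
    (hfst : ∀ e, D.fst (g e) = f (D'.fst e)) (hsnd : ∀ e, D.snd (g e) = f (D'.snd e))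
    (H : Finset β') (X : Finset α') : (D.cut (H.map g) (X.map f)).card = (D'.cut H X).card := by
  rw [← Finset.card_map g]
  congr 1
  ext e
  simp only [mem_cut, Finset.mem_map]
  grind

theorem deg_map {α' β' : Type*} [DecidableEq α'] {D' : Ends α' β'} {f : α' ↪ α} {g : β' ↪ β}
    (hfst : ∀ e, D.fst (g e) = f (D'.fst e)) (hsnd : ∀ e, D.snd (g e) = f (D'.snd e))
    (H : Finset β') (v : α') : D.deg (H.map g) (f v) = D'.deg H v := by
  rw [deg, deg, ← Finset.card_map g]
  congr 1
  ext e
  simp only [mem_star, Finset.mem_map]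
  grind

theorem exists_even_deg_add [Fintype α] [Fintype β] {c : α → ℕ} (hloop : D.Loopless Finset.univ)
    (hcut : D.CutsAtLeast 3 Finset.univ Finset.univ)
    (hc : ∀ v, 3 * c v ≤ 2 * D.deg Finset.univ v) (heven : Even (∑ v, c v)) :
    ∃ J : Finset β, ∀ v, Even (D.deg Finset.univ v + D.deg J v + c v) ∧
      D.deg J v + c v ≤ D.deg Finset.univ v := by
  classical
  have hcard : Even (Fintype.card (D.GadgetVertex c)) := by
    simp only [Fintype.card_sum, Fintype.card_prod, Fintype.card_bool, Fintype.card_sigma,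
      Fintype.card_fin]
    exact (even_two.mul_left _).add heven
  obtain ⟨M, hM⟩ := exists_isPerfectMatching_of_card_le (G := D.gadget c) hcard
    fun Γ _ κ hsurj hκ => card_labels_le hloop hcut hc hκ hsurj
  obtain ⟨m, hm, hadj⟩ := exists_involutive_of_isPerfectMatching hM
  exact exists_even_deg_add_of_involutive hloop hm hadj

theorem exists_odd_join {E : Finset β} {V : Finset α} (hE : D.EdgesIn E V) (hloop : D.Loopless E)
    (hcut : D.CutsAtLeast 3 E V) :
    ∃ J ⊆ E, ∀ v ∈ V, Even (D.deg E v + D.deg J v) ∧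
      D.deg J v + 2 * (D.deg E v / 3) ≤ D.deg E v := by
  let D' : Ends V E := ⟨fun e => ⟨D.fst e, (hE e e.2).1⟩, fun e => ⟨D.snd e, (hE e e.2).2⟩⟩
  have hV : (Finset.univ : Finset V).map (.subtype _) = V := by simp [Finset.attach_map_val]
  have hE' : (Finset.univ : Finset E).map (.subtype _) = E := by simp [Finset.attach_map_val]
  have hdeg (J : Finset E) (v : V) : D.deg (J.map (.subtype _)) v = D'.deg J v :=
    deg_map (f := .subtype _) (fun _ => rfl) (fun _ => rfl) J v
  have hcut' : D'.CutsAtLeast 3 Finset.univ Finset.univ := fun X _ hX hne => by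
    rw [← card_cut_map (f := .subtype _) (g := .subtype _) (fun _ => rfl) fun _ => rfl, hE']
    refine hcut _ (by grind) (by simpa using hX) fun heq => hne ?_
    exact Finset.map_injective _ (heq.trans hV.symm)
  have hloop' : D'.Loopless Finset.univ := fun e _ h => hloop e e.2 (congrArg Subtype.val h)
  obtain ⟨J, hJ⟩ := exists_even_deg_add (c := fun v => 2 * (D'.deg Finset.univ v / 3)) hloop' hcut'
    (fun v => by lia) (Finset.even_sum _ fun v _ => even_two_mul _)
  refine ⟨J.map (.subtype _), by grind, fun v hv => ?_⟩
  obtain ⟨heven, hle⟩ := hJ ⟨v, hv⟩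
  rw [← hdeg, ← hdeg, hE'] at heven hle
  exact ⟨by grind, hle⟩

end OddJoin

end Ends

section Doubling

variable {α β : Type*} {G : Graph α β} {J : Set β} {x y : α}

/-- The graph obtained from `G` by adding a parallel copy of every edge in `J`. The copy of the edge
`e` is `.inr e`. -/
def doubling (G : Graph α β) (J : Set β) : Graph α (β ⊕ β) where
  vertexSet := V(G)
  edgeSet := {e | e.elim (· ∈ E(G)) (· ∈ E(G) ∩ J)}
  IsLink e x y := e.elim (G.IsLink · x y) fun f => G.IsLink f x y ∧ f ∈ J
  isLink_symm e _ := by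
    rcases e with e | e
    exacts [⟨fun _ _ h => Graph.IsLink.symm h⟩, ⟨fun _ _ h => ⟨h.1.symm, h.2⟩⟩]
  eq_or_eq_of_isLink_of_isLink e _ _ _ _ h h' := by
    rcases e with e | e
    exacts [Graph.IsLink.left_eq_or_eq h h', h.1.left_eq_or_eq h'.1]
  edge_mem_iff_exists_isLink e := by
    rcases e with e | e <;> simp [Graph.edge_mem_iff_exists_isLink]
  left_mem_of_isLink e _ _ h := by
    rcases e with e | e
    exacts [Graph.IsLink.left_mem h, h.1.left_mem]

theorem doubling_isLink_imp {e : β ⊕ β} (h : (doubling G J).IsLink e x y) :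
    G.IsLink (e.elim id id) x y := by
  rcases e with e | e
  exacts [h, h.1]

instance [G.Loopless] : (doubling G J).Loopless where
  not_isLoopAt _ x h := Graph.Loopless.not_isLoopAt (G := G) _ x (doubling_isLink_imp h)

theorem exists_walk_of_doubling (p : (doubling G J).Walk x y) :
    ∃ q : G.Walk x y, q.support = p.support ∧ (q.edges = [] ↔ p.edges = []) := by
  induction p with
  | nil hx => exact ⟨.nil hx, rfl, by simp [Graph.Walk.edges]⟩
  | cons e h p ih =>
    obtain ⟨q, hq, -⟩ := ih
    exact ⟨.cons _ (doubling_isLink_imp h) q, congrArg (_ :: ·) hq, by simp [Graph.Walk.edges]⟩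

theorem hasFWalk_of_hasFTrail_doubling {f : α → ℤ} (h : (doubling G J).HasFTrail f) :
    G.HasFWalk f := by
  obtain ⟨x, p, -, hspan, hvisits⟩ := h
  obtain ⟨q, hsupport, hedges⟩ := exists_walk_of_doubling p
  refine ⟨x, q, fun z hz => hsupport ▸ hspan z hz, fun z hz => ?_⟩
  simpa only [Graph.Walk.visits, hsupport, hedges] using hvisits z hz

end Doubling

namespace Ends

section Doubling

variable {α β : Type*} (D : Ends α β)

/-- The ends of the edges of the graph `Multigraph.doubling`. -/
def doubling : Ends α (β ⊕ β) := ⟨Sum.elim D.fst D.fst, Sum.elim D.snd D.snd⟩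

variable {D} {E J : Finset β} {V : Finset α} {G : Graph α β}

theorem Presents.doubling (hD : D.Presents E V G) (hJ : J ⊆ E) :
    D.doubling.Presents (E.disjSum J) V (Multigraph.doubling G J) where
  coe_vertexSet := hD.coe_vertexSet
  coe_edgeSet := by
    ext (e | e)
    · simp [Multigraph.doubling, hD.mem_edgeSet]
    · simpa [Multigraph.doubling, hD.mem_edgeSet] using @hJ e
  isLink e he := by
    rcases e with e | e
    · exact hD.isLink e (Finset.inl_mem_disjSum.1 he)
    · have heJ := Finset.inr_mem_disjSum.1 he
      exact ⟨hD.isLink e (hJ heJ), heJ⟩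

variable [DecidableEq α]

theorem deg_doubling (E J : Finset β) (v : α) :
    D.doubling.deg (E.disjSum J) v = D.deg E v + D.deg J v := by
  rw [deg, deg, deg, ← Finset.card_disjSum]
  congr 1
  ext (e | e) <;> simp [mem_star, doubling]

theorem card_cut_doubling (E J : Finset β) (X : Finset α) :
    (D.doubling.cut (E.disjSum J) X).card = (D.cut E X).card + (D.cut J X).card := by
  rw [← Finset.card_disjSum]
  congr 1
  ext (e | e) <;> simp [mem_cut, doubling]

theorem CutsAtLeast.doubling {k : ℕ} (hcut : D.CutsAtLeast k E V) :
    D.doubling.CutsAtLeast (2 * k) (E.disjSum E) V := by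
  intro X hX hne hXV
  rw [card_cut_doubling, ← two_mul]
  exact Nat.mul_le_mul_left 2 (hcut X hX hne hXV)

theorem CutsAtLeast.doubling_of_even_deg {k : ℕ} (hcut : D.CutsAtLeast k E V) (hk : Odd k)
    (hloop : D.Loopless E) (hJ : J ⊆ E) (heven : ∀ v ∈ V, Even (D.deg E v + D.deg J v)) :
    D.doubling.CutsAtLeast (k + 1) (E.disjSum J) V := by
  intro X hX hne hXV
  have hsum : Even (∑ v ∈ X, (D.deg E v + D.deg J v)) :=
    Finset.even_sum _ fun v hv => heven v (hX hv)
  rw [Finset.sum_add_distrib, hloop.sum_deg, (hloop.mono hJ).sum_deg] at hsum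
  have := hcut X hX hne hXV
  rw [card_cut_doubling]
  grind

end Doubling

section Trails

variable {α β : Type*} {D : Ends α β} {E J K : Finset β} {V : Finset α} {G : Graph α β}
  [DecidableEq α] [G.Loopless] {f : α → ℤ} {k : ℕ}

theorem Presents.hasFTrail_of_connects (hD : D.Presents E V G) (hne : V.Nonempty) (hK : K ⊆ E)
    (hconn : D.Connects K V) (heven : ∀ v ∈ V, Even (D.deg K v))
    (hf : ∀ v ∈ V, 1 ≤ f v ∧ D.deg K v ≤ 2 * f v + 1) : G.HasFTrail f := by
  obtain ⟨x, hx⟩ := hne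
  obtain ⟨p, hp, hspan⟩ := hD.exists_spanning_closed_trail hK hconn heven (hD.mem_vertexSet.2 hx)
  refine ⟨x, p, hp.1, hspan, fun z hz => ?_⟩
  obtain ⟨hpos, hdeg⟩ := hf z (hD.mem_vertexSet.1 hz)
  have := hD.visits_le hp (n := (f z).toNat) (z := z) (by lia) (by lia)
  lia

theorem Presents.hasFTrail_of_cutsAtLeast (hD : D.Presents E V G) (hne : V.Nonempty) (hk : 4 ≤ k)
    (hcut : D.CutsAtLeast k E V)
    (hf : ∀ v ∈ V, 1 ≤ f v ∧ 2 * (D.deg E v : ℤ) + 4 * k ≤ k * (2 * f v + 1) + 8) :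
    G.HasFTrail f := by
  obtain ⟨K, hK, hconn, hdeg⟩ := exists_connects_even_deg_le hk hne hD.edgesIn hD.loopless hcut
    (h := fun v => (2 * f v + 1).toNat) fun v hv => by
      obtain ⟨hpos, hle⟩ := hf v hv
      zify
      rwa [Int.toNat_of_nonneg (by lia)]
  refine hD.hasFTrail_of_connects hne hK hconn (fun v hv => (hdeg v hv).1) fun v hv => ?_
  have hpos := (hf v hv).1
  have hle := (hdeg v hv).2
  lia

theorem Presents.hasFWalk_of_cutsAtLeast_doubling (hD : D.Presents E V G) (hne : V.Nonempty)
    (hJ : J ⊆ E) (hcut : D.doubling.CutsAtLeast 4 (E.disjSum J) V)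
    (hf : ∀ v ∈ V, D.deg E v + D.deg J v + 2 ≤ 4 * f v) : G.HasFWalk f := by
  refine hasFWalk_of_hasFTrail_doubling
    ((hD.doubling hJ).hasFTrail_of_cutsAtLeast hne le_rfl hcut fun v hv => ?_)
  have := hf v hv
  rw [deg_doubling]
  lia

theorem Presents.hasFWalk_of_cutsAtLeast_one (hD : D.Presents E V G) (hne : V.Nonempty)
    (hcut : D.CutsAtLeast 1 E V) (hf : ∀ v ∈ V, 1 ≤ f v ∧ D.deg E v ≤ f v) : G.HasFWalk f := by
  refine hasFWalk_of_hasFTrail_doubling ((hD.doubling subset_rfl).hasFTrail_of_connects hne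
    subset_rfl (fun X hX hXne hXV => ?_) (fun v _ => ?_) fun v hv => ?_)
  · exact Finset.card_pos.1 (two_pos.trans_le (hcut.doubling X hX hXne hXV))
  · exact deg_doubling E E v ▸ ⟨_, rfl⟩
  · have := hf v hv
    rw [deg_doubling]
    lia

theorem Presents.hasFWalk_of_cutsAtLeast_two (hD : D.Presents E V G) (hne : V.Nonempty)
    (hcut : D.CutsAtLeast 2 E V) (hf : ∀ v ∈ V, D.deg E v + 1 ≤ 2 * f v) : G.HasFWalk f :=
  hD.hasFWalk_of_cutsAtLeast_doubling hne subset_rfl hcut.doubling fun v hv => by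
    have := hf v hv
    lia

theorem Presents.hasFWalk_of_cutsAtLeast_three (hD : D.Presents E V G) (hne : V.Nonempty)
    (hcut : D.CutsAtLeast 3 E V) (hf : ∀ v ∈ V, D.deg E v + 2 ≤ 3 * f v) : G.HasFWalk f := by
  obtain ⟨J, hJ, hdeg⟩ := exists_odd_join hD.edgesIn hD.loopless hcut
  refine hD.hasFWalk_of_cutsAtLeast_doubling hne hJ
    (hcut.doubling_of_even_deg (by decide) hD.loopless hJ fun v hv => (hdeg v hv).1) fun v hv => ?_
  have := hf v hv
  have := (hdeg v hv).2
  lia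

end Trails

section Factor

variable {α β : Type*} {D : Ends α β} {E : Finset β} {V : Finset α} {G : Graph α β}
  [DecidableEq α] {k : ℕ} {v : α}

theorem Presents.connected (hD : D.Presents E V G) (hne : V.Nonempty) (hconn : D.Connects E V) :
    G.Connected := by
  classical
  obtain ⟨v, hv⟩ := hne
  refine ⟨⟨v, hD.mem_vertexSet.2 hv⟩, fun x hx y hy => ?_⟩
  rw [hD.mem_vertexSet] at hx hy
  let X : Finset α := V.filter fun z => Nonempty (G.Walk x z)
  by_cases hX : X = V
  · exact (Finset.mem_filter.1 (hX.symm ▸ hy : y ∈ X)).2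
  have hxX : x ∈ X := Finset.mem_filter.2 ⟨hx, ⟨.nil (hD.mem_vertexSet.2 hx)⟩⟩
  have hstep {e a b} (h : G.IsLink e a b) (ha : a ∈ X) : b ∈ X := by
    obtain ⟨p⟩ := (Finset.mem_filter.1 ha).2
    obtain ⟨r, -⟩ := exists_walk_append p (.cons e h (.nil h.right_mem))
    exact Finset.mem_filter.2 ⟨hD.mem_vertexSet.1 h.right_mem, ⟨r⟩⟩
  obtain ⟨e, he⟩ := hconn X (Finset.filter_subset _ _) ⟨x, hxX⟩ hX
  obtain ⟨heE, hcut⟩ := mem_cut.1 he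
  exact absurd ⟨hstep (hD.isLink e heE), hstep (hD.isLink e heE).symm⟩ hcut

theorem Connects.deg_pos (hconn : D.Connects E V) (hv : v ∈ V) (hV : V.Nontrivial) :
    0 < D.deg E v := by
  obtain ⟨e, he⟩ := hconn {v} (Finset.singleton_subset_iff.2 hv) (Finset.singleton_nonempty v)
    hV.ne_singleton.symm
  exact Finset.card_pos.2 ⟨e, by grind [mem_cut, mem_star]⟩

theorem Presents.exists_isFactor_connected [G.Loopless] (hD : D.Presents E V G)
    (hV : V.Nontrivial) (hk : 4 ≤ k) (hcut : D.CutsAtLeast k E V)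
    (hdeg : ∀ v ∈ V, 2 * D.deg E v ≤ k + 8) :
    ∃ H : Graph α β, H.IsFactor G {2, 4} ∧ H.Connected := by
  obtain ⟨K, hK, hconn, hKdeg⟩ := exists_connects_even_deg_le (h := fun _ => 5) hk hV.nonempty
    hD.edgesIn hD.loopless hcut fun v hv => by linarith [hdeg v hv]
  have hDK := hD.restrict hK
  refine ⟨G.restrict K, ⟨⟨Graph.restrict_le, rfl⟩, fun v hv => ?_⟩,
    hDK.connected hV.nonempty hconn⟩
  rw [hDK.mem_vertexSet] at hv
  obtain ⟨⟨m, hm⟩, hle⟩ := hKdeg v hv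
  have hpos := hconn.deg_pos hv hV
  rw [hDK.degree_eq, Set.mem_insert_iff, Set.mem_singleton_iff]
  lia

end Factor

section EdgeConnected

variable {α β : Type*}

theorem EdgesIn.nontrivial {D : Ends α β} {E : Finset β} {V : Finset α} {e : β}
    (hE : D.EdgesIn E V) (hloop : D.Loopless E) (he : e ∈ E) : V.Nontrivial :=
  ⟨D.fst e, (hE e he).1, D.snd e, (hE e he).2, hloop e he⟩

theorem exists_presents_cutsAtLeast [DecidableEq α] {G : Graph α β} {k : ℕ} (hV : V(G).Finite)
    (hE : E(G).Finite) (hk : 0 < k) (hG : G.EdgeConnected k) :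
    ∃ (D : Ends α β) (E : Finset β) (V : Finset α),
      D.Presents E V G ∧ V.Nonempty ∧ D.CutsAtLeast k E V := by
  have hne : V(G).Nonempty := (hG ∅ (by simp) hk).1
  obtain ⟨D, E, V, hD⟩ := exists_presents G hne hV hE
  exact ⟨D, E, V, hD, Finset.coe_nonempty.1 (hD.coe_vertexSet ▸ hne), hD.cutsAtLeast hG⟩

end EdgeConnected

end Ends

theorem ceil_trail_bound {k : ℕ} (hk : 4 ≤ k) (d : ℕ) :
    1 ≤ ⌈((d : ℚ) + (k : ℚ) / 2 - 4) / (k : ℚ)⌉ + 1 ∧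
      2 * (d : ℤ) + 4 * k ≤ k * (2 * (⌈((d : ℚ) + (k : ℚ) / 2 - 4) / (k : ℚ)⌉ + 1) + 1) + 8 := by
  have hk' : (4 : ℚ) ≤ k := by exact_mod_cast hk
  have hkpos : (0 : ℚ) < k := by linarith
  have hnonneg : -1 < ⌈((d : ℚ) + (k : ℚ) / 2 - 4) / (k : ℚ)⌉ := by
    rw [Int.lt_ceil, lt_div_iff₀ hkpos]
    push_cast
    linarith [d.cast_nonneg (α := ℚ)]
  have hle := Int.le_ceil (((d : ℚ) + (k : ℚ) / 2 - 4) / (k : ℚ))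
  rw [div_le_iff₀ hkpos] at hle
  refine ⟨by lia, ?_⟩
  qify
  linarith

theorem ceil_walk_bound {k : ℕ} (hk : 1 ≤ k) (d : ℕ) :
    (d : ℤ) + k ≤ k * (⌈((d : ℚ) - 1) / (k : ℚ)⌉ + 1) + 1 := by
  have hle := Int.le_ceil (((d : ℚ) - 1) / (k : ℚ))
  rw [div_le_iff₀ (by exact_mod_cast hk)] at hle
  qify
  linarith

section EdgeConnected

variable {α β : Type*} {G : Graph α β} [G.Loopless] {k r : ℕ}

theorem hasFTrail_of_edgeConnected (hV : V(G).Finite) (hE : E(G).Finite) (hk : 4 ≤ k)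
    (hG : G.EdgeConnected k) :
    G.HasFTrail (fun x => ⌈((G.degree x : ℚ) + (k : ℚ) / 2 - 4) / (k : ℚ)⌉ + 1) := by
  classical
  obtain ⟨D, E, V, hD, hne, hcut⟩ := Ends.exists_presents_cutsAtLeast hV hE (by lia) hG
  refine hD.hasFTrail_of_cutsAtLeast hne hk hcut fun v _ => ?_
  rw [← hD.degree_eq]
  exact ceil_trail_bound hk _

theorem hasFWalk_of_edgeConnected (hV : V(G).Finite) (hE : E(G).Finite) (hk₁ : 1 ≤ k)
    (hk₃ : k ≤ 3) (hnontrivial : k = 1 → V(G).Nontrivial) (hG : G.EdgeConnected k) :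
    G.HasFWalk (fun x => ⌈((G.degree x : ℚ) - 1) / (k : ℚ)⌉ + 1) := by
  classical
  obtain ⟨D, E, V, hD, hne, hcut⟩ := Ends.exists_presents_cutsAtLeast hV hE hk₁ hG
  have hbound (v) := ceil_walk_bound hk₁ (G.degree v)
  simp only [hD.degree_eq] at hbound ⊢
  obtain rfl | rfl | rfl : k = 1 ∨ k = 2 ∨ k = 3 := by lia
  · refine hD.hasFWalk_of_cutsAtLeast_one hne hcut fun v hv => ?_
    have hconn : D.Connects E V := fun X hX hXne hXV => Finset.card_pos.1 (hcut X hX hXne hXV)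
    have hVnontrivial : V.Nontrivial := by
      simpa only [Finset.Nontrivial, hD.coe_vertexSet] using hnontrivial rfl
    have := hconn.deg_pos hv hVnontrivial
    have := hbound v
    lia
  · exact hD.hasFWalk_of_cutsAtLeast_two hne hcut fun v _ => by
      have := hbound v
      push_cast at this ⊢
      lia
  · exact hD.hasFWalk_of_cutsAtLeast_three hne hcut fun v _ => by
      have := hbound v
      push_cast at this ⊢
      lia

theorem exists_isFactor_connected_of_edgeConnected (hV : V(G).Finite) (hE : E(G).Finite)
    (hr₄ : 4 ≤ r) (hr₈ : r ≤ 8) (hG : G.EdgeConnected r) (hreg : G.IsRegular r) :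
    ∃ H : Graph α β, H.IsFactor G {2, 4} ∧ H.Connected := by
  classical
  obtain ⟨D, E, V, hD, ⟨v, hv⟩, hcut⟩ := Ends.exists_presents_cutsAtLeast hV hE (by lia) hG
  have hdeg (v) (hv : v ∈ V) : D.deg E v = r :=
    (hD.degree_eq v).symm.trans (hreg v (hD.mem_vertexSet.2 hv))
  obtain ⟨e, he⟩ := Finset.card_pos.1 ((by lia : 0 < r).trans_eq (hdeg v hv).symm)
  have hnontrivial := hD.edgesIn.nontrivial hD.loopless (Ends.mem_star.1 he).1
  exact hD.exists_isFactor_connected hnontrivial hr₄ hcut fun v hv => by rw [hdeg v hv]; lia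

end EdgeConnected

end Multigraph

theorem mainTheorem12 {α : Type u} {β : Type v} (G : Graph α β) [G.Loopless]
    (hV : V(G).Finite) (hE : E(G).Finite) :
    (∀ k : ℕ, 4 ≤ k → G.EdgeConnected k →
      G.HasFTrail (fun x => ⌈((G.degree x : ℚ) + (k : ℚ) / 2 - 4) / (k : ℚ)⌉ + 1)) ∧
    (∀ k : ℕ, 1 ≤ k → k ≤ 3 → (k = 1 → V(G).Nontrivial) → G.EdgeConnected k →
      G.HasFWalk (fun x => ⌈((G.degree x : ℚ) - 1) / (k : ℚ)⌉ + 1)) ∧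
    (∀ r : ℕ, 4 ≤ r → r ≤ 8 → G.EdgeConnected r → G.IsRegular r →
      ∃ H : Graph α β, H.IsFactor G {2, 4} ∧ H.Connected) :=
  ⟨fun _ hk hG => Multigraph.hasFTrail_of_edgeConnected hV hE hk hG,
    fun _ hk₁ hk₃ hnontrivial hG =>
      Multigraph.hasFWalk_of_edgeConnected hV hE hk₁ hk₃ hnontrivial hG,
    fun _ hr₄ hr₈ hG hreg =>
      Multigraph.exists_isFactor_connected_of_edgeConnected hV hE hr₄ hr₈ hG hreg⟩
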